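/- Let $U\subset\mathbb R^2$ be a domain and let $f:U\to\mathbb R^3$ be a $C^\infty$ frontal with smooth unit normal vector field $\nu:U\to\mathbb R^3$, i.e. $|\nu|=1$ and $\langle df(X),\nu\rangle=0$ for every tangent vector $X$. Put $\lambda=\det(f_u,f_v,\nu)$. A point is singular if $\lambda=0$ there, and a singular point is non-degenerate if moreover $d\lambda\neq0$ there. Let $II(X,Y)=-\langle df(X),d\nu(Y)\rangle$ be the second fundamental form on $U$, and let $K$ be the Gaussian curvature (the determinant of $II$ divided by that of the first fundamental form), defined on the regular (non-singular) points of $U$. Let $p\in U$ be a cuspidal cross cap, i.e. the germ of $f$ at $p$ is transformed into the germ of $(u,v)\mapsto(u,v^2,uv^3)$ at $(0,0)$ by local $C^\infty$ diffeomorphisms of $\mathbb R^2$ and $\mathbb R^3$. Let $\gamma:(-\varepsilon,\varepsilon)\to U$ be a smooth regular curve with $\gamma(0)=p$ consisting of non-degenerate singular points of $f$ (a singular curve). Then there is $\varepsilon_0\in(0,\varepsilon]$ such that the following hold. 1. For every $\delta\in(0,\varepsilon_0]$, with $J_\delta=\gamma((-\delta,\delta))$: the Gaussian curvature $K$ is bounded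 (at the regular points) on some open neighborhood of $J_\delta$ in $U$ if and only if $II$ vanishes at every point of $J_\delta$. 2. For every $t\in(-\varepsilon_0,\varepsilon_0)$ there is a null vector $\eta(t)$, i.e. $df(\eta(t))=0$, such that $(\gamma'(t),\eta(t))$ is a positively oriented frame of $\mathbb R^2$, so that the singular curvature $$\kappa_s(t)=\operatorname{sgn}\bigl(d\lambda(\eta(t))\bigr)\,\frac{\det\bigl(c'(t),c''(t),\nu(\gamma(t))\bigr)}{|c'(t)|^3},\qquad c=f\circ\gamma,$$ is defined. If $V\subset U$ is an open neighborhood of $p$ and $K\ge0$ at all regular points of $V$, then $\kappa_s(t)\le0$ for all $t\in(-\varepsilon_0,\varepsilon_0)$ with $\gamma(t)\in V$. -/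

import Mathlib

open Set
open scoped ContDiff InnerProductSpace

/-- Euclidean 3-space. -/
abbrev E3 : Type := EuclideanSpace ℝ (Fin 3)

namespace Frontal

noncomputable section

/-- The determinant of three vectors of `ℝ³` (the Euclidean volume form). -/
def det3 (a b c : E3) : ℝ :=
  Matrix.det (Matrix.of ![fun i => a i, fun i => b i, fun i => c i])

/-- `f` is a smooth map on `U` and `ν` is a smooth unit normal vector field of `f` on `U`;
that is, `f` is a frontal on `U` with unit normal vector field `ν`. -/
structure IsFrontalWith (f ν : ℝ × ℝ → E3) (U : Set (ℝ × ℝ)) : Prop where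
  smooth : ContDiffOn ℝ ∞ f U
  smooth_normal : ContDiffOn ℝ ∞ ν U
  unit : ∀ x ∈ U, ‖ν x‖ = 1
  perp : ∀ x ∈ U, ∀ X : ℝ × ℝ, ⟪fderiv ℝ f x X, ν x⟫_ℝ = 0

/-- The signed area density function `λ = det (f_u, f_v, ν)`. -/
def areaDensity (f ν : ℝ × ℝ → E3) (x : ℝ × ℝ) : ℝ :=
  det3 (fderiv ℝ f x (1, 0)) (fderiv ℝ f x (0, 1)) (ν x)

/-- A singular point: a zero of the signed area density. As `ν` is a unit normal, this says
that `f_u` and `f_v` are linearly dependent, i.e. that `f` is not an immersion at `x`. -/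
def IsSingularPt (f ν : ℝ × ℝ → E3) (x : ℝ × ℝ) : Prop :=
  areaDensity f ν x = 0

/-- A non-degenerate singular point: `λ = 0` and `dλ ≠ 0`. -/
def IsNondegSingularPt (f ν : ℝ × ℝ → E3) (x : ℝ × ℝ) : Prop :=
  IsSingularPt f ν x ∧ fderiv ℝ (areaDensity f ν) x ≠ 0

/-- The first fundamental form. -/
def firstForm (f : ℝ × ℝ → E3) (x X Y : ℝ × ℝ) : ℝ :=
  ⟪fderiv ℝ f x X, fderiv ℝ f x Y⟫_ℝ

/-- The second fundamental form `- ⟨df, dν⟩`, defined also at the singular points. -/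
def secondForm (f ν : ℝ × ℝ → E3) (x X Y : ℝ × ℝ) : ℝ :=
  - ⟪fderiv ℝ f x X, fderiv ℝ ν x Y⟫_ℝ

/-- The Gaussian curvature `(L N - M²) / (E G - F²)`; meaningful at regular points only. -/
def gaussCurvature (f ν : ℝ × ℝ → E3) (x : ℝ × ℝ) : ℝ :=
  (secondForm f ν x (1, 0) (1, 0) * secondForm f ν x (0, 1) (0, 1)
      - secondForm f ν x (1, 0) (0, 1) ^ 2) /
    (firstForm f x (1, 0) (1, 0) * firstForm f x (0, 1) (0, 1)
      - firstForm f x (1, 0) (0, 1) ^ 2)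

/-- The standard cuspidal cross cap `(u, v) ↦ (u, v², u v³)`. -/
def stdCuspidalCrossCap (x : ℝ × ℝ) : E3 :=
  !₂[x.1, x.2 ^ 2, x.1 * x.2 ^ 3]

/-- The germ of `f : U → ℝ³` at `p` is right-left equivalent to the germ of `g` at `q`:
there are local diffeomorphisms `φ` of `ℝ²` near `p` and `Φ` of `ℝ³` near `f p` with
`φ p = q`, `Φ (f p) = g q` and `g ∘ φ = Φ ∘ f` near `p`. -/
def AEquivAt (f : ℝ × ℝ → E3) (U : Set (ℝ × ℝ)) (p : ℝ × ℝ)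
    (g : ℝ × ℝ → E3) (q : ℝ × ℝ) : Prop :=
  ∃ (φ : OpenPartialHomeomorph (ℝ × ℝ) (ℝ × ℝ)) (Φ : OpenPartialHomeomorph E3 E3),
    ContDiffOn ℝ ∞ φ φ.source ∧ ContDiffOn ℝ ∞ φ.symm φ.target ∧
    ContDiffOn ℝ ∞ Φ Φ.source ∧ ContDiffOn ℝ ∞ Φ.symm Φ.target ∧
    p ∈ φ.source ∧ φ.source ⊆ U ∧ φ p = q ∧
    MapsTo f φ.source Φ.source ∧ ∀ x ∈ φ.source, Φ (f x) = g (φ x)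

/-- `f : U → ℝ³` has a cuspidal cross cap at `p`. -/
def IsCuspidalCrossCap (f : ℝ × ℝ → E3) (U : Set (ℝ × ℝ)) (p : ℝ × ℝ) : Prop :=
  AEquivAt f U p stdCuspidalCrossCap (0, 0)

/-- `γ : (-ε, ε) → U` is a singular curve through `p = γ 0`: a smooth regular curve
consisting of non-degenerate singular points of `f`. -/
structure IsSingularCurve (f ν : ℝ × ℝ → E3) (U : Set (ℝ × ℝ)) (p : ℝ × ℝ)
    (γ : ℝ → ℝ × ℝ) (ε : ℝ) : Prop where
  pos : 0 < ε
  smooth : ContDiffOn ℝ ∞ γ (Ioo (-ε) ε)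
  regular : ∀ t ∈ Ioo (-ε) ε, deriv γ t ≠ 0
  base : γ 0 = p
  mem : ∀ t ∈ Ioo (-ε) ε, γ t ∈ U
  nondeg : ∀ t ∈ Ioo (-ε) ε, IsNondegSingularPt f ν (γ t)

/-- The Gaussian curvature (a function on the regular points) is bounded on some open
neighbourhood, contained in `U`, of the set `J`. -/
def CurvatureBoundedNear (f ν : ℝ × ℝ → E3) (U J : Set (ℝ × ℝ)) : Prop :=
  ∃ V : Set (ℝ × ℝ), IsOpen V ∧ V ⊆ U ∧ J ⊆ V ∧
    ∃ C : ℝ, ∀ x ∈ V, ¬ IsSingularPt f ν x → |gaussCurvature f ν x| ≤ C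

/-- The second fundamental form vanishes at every point of `J`. -/
def SecondFormVanishesOn (f ν : ℝ × ℝ → E3) (J : Set (ℝ × ℝ)) : Prop :=
  ∀ x ∈ J, ∀ X Y : ℝ × ℝ, secondForm f ν x X Y = 0

/-- `η` is a null vector of `f` at `γ t` such that `(γ' t, η)` is a positively oriented
frame of `ℝ²`. -/
def IsPositiveNullVector (f : ℝ × ℝ → E3) (γ : ℝ → ℝ × ℝ) (t : ℝ) (η : ℝ × ℝ) : Prop :=
  fderiv ℝ f (γ t) η = 0 ∧ 0 < (deriv γ t).1 * η.2 - (deriv γ t).2 * η.1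

/-- The singular curvature
`sgn (dλ(η)) det (c', c'', ν) / |c'|³` with `c = f ∘ γ`,
where `η` is a null vector such that `(γ', η)` is positively oriented
(it does not depend on which such `η` is taken). -/
def singularCurvature (f ν : ℝ × ℝ → E3) (γ : ℝ → ℝ × ℝ) (t : ℝ) (η : ℝ × ℝ) : ℝ :=
  SignType.sign (fderiv ℝ (areaDensity f ν) (γ t) η) *
    det3 (deriv (f ∘ γ) t) (deriv (deriv (f ∘ γ)) t) (ν (γ t)) /
      ‖deriv (f ∘ γ) t‖ ^ 3

end

end Frontal

open Frontal

namespace Frontal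

open Filter Topology

/-! ### Linear algebra in `ℝ³` and `ℝ²` -/

/-! Pull the frontal back by the source diffeomorphism of the cuspidal cross cap. This gives
coordinates `(u, v)` in which the singular set is `v = 0` and `F_v = v h`, with `F_u`, `h`, `N` a
frame even at singular points. Put `μ = det (F_u, h, N)`, `L = -⟪F_u, N_u⟫`, `m = -⟪h, N_u⟫`, `n =
-⟪h, N_v⟫ = ⟪h_v, N⟫`. Then `λ = v μ`, and the other two coefficients of the second fundamental form
are `v m` and `v n`, so that `K v μ² = L n - v m²` off the axis (`gaussCurvature_mul`). On the axis
the second fundamental form is `L du²`, and `n` is nonzero except possibly at the cross cap `u = 0`.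

Boundedness: if `K` is bounded, letting `v → 0` gives `L n = 0` on the axis, hence `L = 0` for `u ≠
0` and, by continuity, at `u = 0`. Conversely, if `L = 0` on the axis then `L = O(v)`, and the
identity bounds `K`.

Sign: if `K ≥ 0`, then `v L n ≥ 0`, so `L n` vanishes on the axis with nonnegative `v`-derivative;
hence `L = 0` and `L_v n ≥ 0` there. Expanding `F_uu` in the frame gives `L_v μ = -n det (F_u, F_uu,
N)` (`fderiv_coeffL_mul`), so `n² μ det (F_u, F_uu, N) ≤ 0`. Dividing by `n²` off `u = 0` and using
continuity at `u = 0` gives `μ det (F_u, F_uu, N) ≤ 0`, and the left side has the sign of the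
singular curvature (`singularCurvature_nonpos`). -/

lemma det3_eq (a b c : E3) : det3 a b c =
    a 0 * (b 1 * c 2 - b 2 * c 1) - a 1 * (b 0 * c 2 - b 2 * c 0)
      + a 2 * (b 0 * c 1 - b 1 * c 0) := by
  simp [det3, Matrix.det_fin_three]
  ring

lemma inner_eq (a b : E3) : ⟪a, b⟫_ℝ = a 0 * b 0 + a 1 * b 1 + a 2 * b 2 := by
  simp [PiLp.inner_apply, Fin.sum_univ_three]
  ring

/-- Cramer's rule, paired with a vector `x`. -/
lemma det3_mul_inner (a h N b x : E3) :
    det3 a h N * ⟪b, x⟫_ℝ =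
      det3 b h N * ⟪a, x⟫_ℝ + det3 a b N * ⟪h, x⟫_ℝ + det3 a h b * ⟪N, x⟫_ℝ := by
  simp only [det3_eq, inner_eq]
  ring

/-- The Gram determinant. -/
lemma det3_sq (a b c : E3) : det3 a b c ^ 2 =
    ⟪a, a⟫_ℝ * (⟪b, b⟫_ℝ * ⟪c, c⟫_ℝ - ⟪b, c⟫_ℝ ^ 2)
      - ⟪a, b⟫_ℝ * (⟪a, b⟫_ℝ * ⟪c, c⟫_ℝ - ⟪b, c⟫_ℝ * ⟪a, c⟫_ℝ)
      + ⟪a, c⟫_ℝ * (⟪a, b⟫_ℝ * ⟪b, c⟫_ℝ - ⟪b, b⟫_ℝ * ⟪a, c⟫_ℝ) := by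
  simp only [det3_eq, inner_eq]
  ring

lemma det3_sq_of_unit_normal {a b c : E3} (hac : ⟪a, c⟫_ℝ = 0) (hbc : ⟪b, c⟫_ℝ = 0)
    (hc : ‖c‖ = 1) : det3 a b c ^ 2 = ⟪a, a⟫_ℝ * ⟪b, b⟫_ℝ - ⟪a, b⟫_ℝ ^ 2 := by
  rw [det3_sq, hac, hbc, real_inner_self_eq_norm_sq c, hc]
  ring

lemma clm_prod_apply {E : Type*} [NormedAddCommGroup E] [NormedSpace ℝ E]
    (B : ℝ × ℝ →L[ℝ] E) (z : ℝ × ℝ) : B z = z.1 • B (1, 0) + z.2 • B (0, 1) := by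
  rw [← map_smul, ← map_smul, ← map_add]
  congr 1
  ext <;> simp

/-- The determinant of an endomorphism of `ℝ²`. -/
noncomputable def jac (A : ℝ × ℝ →L[ℝ] ℝ × ℝ) : ℝ :=
  (A (1, 0)).1 * (A (0, 1)).2 - (A (1, 0)).2 * (A (0, 1)).1

lemma jac_comp (A B : ℝ × ℝ →L[ℝ] ℝ × ℝ) : jac (A.comp B) = jac A * jac B := by
  simp only [jac, ContinuousLinearMap.comp_apply]
  rw [clm_prod_apply A (B (1, 0)), clm_prod_apply A (B (0, 1))]
  simp
  ring

lemma jac_ne_zero_of_comp_eq_id {A B : ℝ × ℝ →L[ℝ] ℝ × ℝ}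
    (h : A.comp B = ContinuousLinearMap.id ℝ (ℝ × ℝ)) : jac B ≠ 0 := by
  intro hB
  have := jac_comp A B
  rw [h, hB] at this
  simp [jac] at this

/-! ### Frontals -/

variable {f ν : ℝ × ℝ → E3} {U : Set (ℝ × ℝ)}

lemma contDiffOn_fderiv_apply {E : Type*} [NormedAddCommGroup E] [NormedSpace ℝ E]
    {g : ℝ × ℝ → E} (hU : IsOpen U) (hg : ContDiffOn ℝ ∞ g U) (X : ℝ × ℝ) :
    ContDiffOn ℝ ∞ (fun x => fderiv ℝ g x X) U :=
  (hg.fderiv_of_isOpen hU (m := ∞) (by simp)).clm_apply contDiffOn_const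

lemma differentiableAt_of_smooth {E : Type*} [NormedAddCommGroup E] [NormedSpace ℝ E]
    {g : ℝ × ℝ → E} (hU : IsOpen U) (hg : ContDiffOn ℝ ∞ g U) {x : ℝ × ℝ} (hx : x ∈ U) :
    DifferentiableAt ℝ g x :=
  (hg.contDiffAt (hU.mem_nhds hx)).differentiableAt (by simp)

lemma fderiv_fderiv_apply_comm {E : Type*} [NormedAddCommGroup E] [NormedSpace ℝ E]
    {g : ℝ × ℝ → E} (hU : IsOpen U) (hg : ContDiffOn ℝ ∞ g U) {x : ℝ × ℝ} (hx : x ∈ U)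
    (X Y : ℝ × ℝ) :
    fderiv ℝ (fun z => fderiv ℝ g z X) x Y = fderiv ℝ (fun z => fderiv ℝ g z Y) x X := by
  have hd : DifferentiableAt ℝ (fderiv ℝ g) x :=
    ((hg.fderiv_of_isOpen hU (m := ∞) (by simp)).contDiffAt
      (hU.mem_nhds hx)).differentiableAt (by simp)
  have hs : IsSymmSndFDerivAt ℝ g x :=
    (hg.contDiffAt (hU.mem_nhds hx)).isSymmSndFDerivAt
      (by simpa using WithTop.coe_le_coe.2 (le_top : (2 : ℕ∞) ≤ ⊤))
  rw [fderiv_clm_apply hd (by fun_prop), fderiv_clm_apply hd (by fun_prop)]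
  simpa using hs Y X

/-- Differentiating the identity `⟪a, b⟫ = k` on an open set. -/
lemma inner_fderiv_add_eq_zero {a b : ℝ × ℝ → E3} {k : ℝ} (hU : IsOpen U)
    {x : ℝ × ℝ} (hx : x ∈ U) (ha : DifferentiableAt ℝ a x) (hb : DifferentiableAt ℝ b x)
    (h : ∀ z ∈ U, ⟪a z, b z⟫_ℝ = k) (Y : ℝ × ℝ) :
    ⟪a x, fderiv ℝ b x Y⟫_ℝ + ⟪fderiv ℝ a x Y, b x⟫_ℝ = 0 := by
  rw [← fderiv_inner_apply ℝ ha hb Y]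
  have : (fun z => ⟪a z, b z⟫_ℝ) =ᶠ[𝓝 x] fun _ => k := by
    filter_upwards [hU.mem_nhds hx] with z hz using h z hz
  rw [this.fderiv_eq]
  simp

/-- Differentiating `⟪f_X, ν⟫ = 0` along `Y` turns either side into minus the pairing of a second
derivative of `f` with `ν`, and second derivatives commute. -/
lemma IsFrontalWith.inner_fderiv_normal_symm (hf : IsFrontalWith f ν U) (hU : IsOpen U)
    {x : ℝ × ℝ} (hx : x ∈ U) (X Y : ℝ × ℝ) :
    ⟪fderiv ℝ f x X, fderiv ℝ ν x Y⟫_ℝ = ⟪fderiv ℝ f x Y, fderiv ℝ ν x X⟫_ℝ := by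
  have key (X Y : ℝ × ℝ) := inner_fderiv_add_eq_zero hU hx
    (differentiableAt_of_smooth hU (contDiffOn_fderiv_apply hU hf.smooth X) hx)
    (differentiableAt_of_smooth hU hf.smooth_normal hx) (fun z hz => hf.perp z hz X) Y
  have h1 := key X Y
  have h2 := key Y X
  rw [fderiv_fderiv_apply_comm hU hf.smooth hx] at h1
  linarith

lemma IsFrontalWith.inner_normal_fderiv_normal (hf : IsFrontalWith f ν U) (hU : IsOpen U)
    {x : ℝ × ℝ} (hx : x ∈ U) (Y : ℝ × ℝ) : ⟪ν x, fderiv ℝ ν x Y⟫_ℝ = 0 := by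
  have hd := differentiableAt_of_smooth hU hf.smooth_normal hx
  have := inner_fderiv_add_eq_zero hU hx hd hd (k := 1)
    (fun z hz => by rw [real_inner_self_eq_norm_sq, hf.unit z hz]; norm_num) Y
  rw [real_inner_comm (ν x)] at this
  linarith [real_inner_comm (ν x) (fderiv ℝ ν x Y)]

lemma secondForm_eq (f ν : ℝ × ℝ → E3) (x X Y : ℝ × ℝ) : secondForm f ν x X Y =
    X.1 * Y.1 * secondForm f ν x (1, 0) (1, 0) + X.1 * Y.2 * secondForm f ν x (1, 0) (0, 1)
      + X.2 * Y.1 * secondForm f ν x (0, 1) (1, 0)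
      + X.2 * Y.2 * secondForm f ν x (0, 1) (0, 1) := by
  simp only [secondForm]
  rw [clm_prod_apply (fderiv ℝ f x) X, clm_prod_apply (fderiv ℝ ν x) Y]
  simp only [inner_add_left, inner_add_right, real_inner_smul_left, real_inner_smul_right]
  ring

lemma firstForm_eq (f : ℝ × ℝ → E3) (x X Y : ℝ × ℝ) : firstForm f x X Y =
    X.1 * Y.1 * firstForm f x (1, 0) (1, 0)
      + (X.1 * Y.2 + X.2 * Y.1) * firstForm f x (1, 0) (0, 1)
      + X.2 * Y.2 * firstForm f x (0, 1) (0, 1) := by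
  simp only [firstForm]
  rw [clm_prod_apply (fderiv ℝ f x) X, clm_prod_apply (fderiv ℝ f x) Y]
  simp only [inner_add_left, inner_add_right, real_inner_smul_left, real_inner_smul_right]
  rw [real_inner_comm (fderiv ℝ f x (1, 0)) (fderiv ℝ f x (0, 1))]
  ring

/-! ### Change of coordinates in the source -/

section Comp

variable {ψ : ℝ × ℝ → ℝ × ℝ} {y : ℝ × ℝ}

lemma fderiv_comp_apply' {g : ℝ × ℝ → E3} (hψ : DifferentiableAt ℝ ψ y)
    (hg : DifferentiableAt ℝ g (ψ y)) (X : ℝ × ℝ) :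
    fderiv ℝ (g ∘ ψ) y X = fderiv ℝ g (ψ y) (fderiv ℝ ψ y X) := by
  rw [fderiv_comp y hg hψ]; rfl

lemma areaDensity_comp (hψ : DifferentiableAt ℝ ψ y) (hf : DifferentiableAt ℝ f (ψ y)) :
    areaDensity (f ∘ ψ) (ν ∘ ψ) y = jac (fderiv ℝ ψ y) * areaDensity f ν (ψ y) := by
  simp only [areaDensity, fderiv_comp_apply' hψ hf, jac, Function.comp]
  rw [clm_prod_apply (fderiv ℝ f (ψ y)) (fderiv ℝ ψ y (1, 0)),
    clm_prod_apply (fderiv ℝ f (ψ y)) (fderiv ℝ ψ y (0, 1))]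
  simp only [det3_eq, PiLp.add_apply, PiLp.smul_apply, smul_eq_mul]
  ring

lemma secondForm_comp (hψ : DifferentiableAt ℝ ψ y) (hf : DifferentiableAt ℝ f (ψ y))
    (hν : DifferentiableAt ℝ ν (ψ y)) (X Y : ℝ × ℝ) :
    secondForm (f ∘ ψ) (ν ∘ ψ) y X Y =
      secondForm f ν (ψ y) (fderiv ℝ ψ y X) (fderiv ℝ ψ y Y) := by
  simp only [secondForm, fderiv_comp_apply' hψ hf, fderiv_comp_apply' hψ hν]

lemma firstForm_comp (hψ : DifferentiableAt ℝ ψ y) (hf : DifferentiableAt ℝ f (ψ y))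
    (X Y : ℝ × ℝ) :
    firstForm (f ∘ ψ) y X Y = firstForm f (ψ y) (fderiv ℝ ψ y X) (fderiv ℝ ψ y Y) := by
  simp only [firstForm, fderiv_comp_apply' hψ hf]

lemma gaussCurvature_comp (hf : IsFrontalWith f ν U) (hU : IsOpen U) (hy : ψ y ∈ U)
    (hψ : DifferentiableAt ℝ ψ y) (hj : jac (fderiv ℝ ψ y) ≠ 0) :
    gaussCurvature (f ∘ ψ) (ν ∘ ψ) y = gaussCurvature f ν (ψ y) := by
  have hfd := differentiableAt_of_smooth hU hf.smooth hy
  have hνd := differentiableAt_of_smooth hU hf.smooth_normal hy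
  have hs : secondForm f ν (ψ y) (0, 1) (1, 0) = secondForm f ν (ψ y) (1, 0) (0, 1) := by
    simp only [secondForm, hf.inner_fderiv_normal_symm hU hy (0, 1) (1, 0)]
  simp only [gaussCurvature, secondForm_comp hψ hfd hνd, firstForm_comp hψ hfd]
  have e2 (X Y : ℝ × ℝ) := secondForm_eq f ν (ψ y) X Y
  have e1 (X Y : ℝ × ℝ) := firstForm_eq f (ψ y) X Y
  rw [hs] at e2
  rw [e2 (fderiv ℝ ψ y (1, 0)) (fderiv ℝ ψ y (1, 0)), e2 (fderiv ℝ ψ y (0, 1)) _,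
    e2 (fderiv ℝ ψ y (1, 0)) (fderiv ℝ ψ y (0, 1)),
    e1 (fderiv ℝ ψ y (1, 0)) (fderiv ℝ ψ y (1, 0)), e1 (fderiv ℝ ψ y (0, 1)) _,
    e1 (fderiv ℝ ψ y (1, 0)) (fderiv ℝ ψ y (0, 1))]
  -- Both determinants scale by the square of the Jacobian, which cancels. This needs no regularity
  -- of the point, since cancelling a nonzero factor is valid over a zero denominator too.
  rw [← mul_div_mul_left _ (firstForm f (ψ y) (1, 0) (1, 0) * firstForm f (ψ y) (0, 1) (0, 1)
      - firstForm f (ψ y) (1, 0) (0, 1) ^ 2) (pow_ne_zero 2 hj)]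
  simp only [jac]
  congr 1 <;> ring

end Comp

/-! ### Limits of functions of one variable -/

lemma nonpos_of_eventually_punctured {g : ℝ → ℝ} {a : ℝ} (hg : ContinuousAt g a)
    (h : ∀ᶠ x in 𝓝[≠] a, g x ≤ 0) : g a ≤ 0 :=
  le_of_tendsto (hg.tendsto.mono_left nhdsWithin_le_nhds) h

lemma eq_zero_of_eventually_punctured {g : ℝ → ℝ} {a : ℝ} (hg : ContinuousAt g a)
    (h : ∀ᶠ x in 𝓝[≠] a, g x = 0) : g a = 0 := by
  refine le_antisymm (nonpos_of_eventually_punctured hg (h.mono fun _ hx => hx.le)) ?_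
  have := nonpos_of_eventually_punctured hg.neg (h.mono fun x hx => (neg_eq_zero.2 hx).le)
  exact neg_nonpos.1 this

/-- The one-sided limits at `0` have opposite weak signs. -/
lemma eq_zero_of_mul_self_nonneg {g : ℝ → ℝ} (hg : ContinuousAt g 0)
    (h : ∀ᶠ v in 𝓝 (0 : ℝ), 0 ≤ v * g v) : g 0 = 0 := by
  have h1 : 0 ≤ g 0 := by
    refine ge_of_tendsto (hg.tendsto.mono_left (nhdsWithin_le_nhds (s := Ioi 0))) ?_
    filter_upwards [nhdsWithin_le_nhds h, self_mem_nhdsWithin] with v hv hv0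
    exact nonneg_of_mul_nonneg_right hv hv0
  have h2 : g 0 ≤ 0 := by
    refine le_of_tendsto (hg.tendsto.mono_left (nhdsWithin_le_nhds (s := Iio 0))) ?_
    filter_upwards [nhdsWithin_le_nhds h, self_mem_nhdsWithin] with v hv hv0
    exact nonpos_of_mul_nonneg_right hv hv0
  exact le_antisymm h2 h1

lemma deriv_nonneg_of_mul_self_nonneg {g : ℝ → ℝ} {g' : ℝ} (hg : HasDerivAt g g' 0)
    (h : ∀ᶠ v in 𝓝 (0 : ℝ), 0 ≤ v * g v) : 0 ≤ g' := by
  have h0 := eq_zero_of_mul_self_nonneg hg.continuousAt h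
  refine ge_of_tendsto (hasDerivAt_iff_tendsto_slope_zero.1 hg) ?_
  filter_upwards [nhdsWithin_le_nhds h] with v hv
  rw [zero_add, h0, sub_zero, smul_eq_mul]
  -- The slope is `v g(v)` times a square; at `v = 0` both sides are `0` because `0⁻¹ = 0`.
  have : v⁻¹ * g v = (v⁻¹) ^ 2 * (v * g v) := by
    rcases eq_or_ne v 0 with rfl | hv0
    · simp
    · field_simp
  rw [this]
  positivity

/-! ### Frontals in coordinates adapted to a cuspidal cross cap -/

lemma continuousAt_snd_line {y : ℝ × ℝ} :
    ContinuousAt (fun v : ℝ => ((y.1, v) : ℝ × ℝ)) y.2 := by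
  fun_prop

/-- If `f_v = v h`, then `h` is tangent to the frontal, also where `v = 0`. -/
lemma IsFrontalWith.inner_normal_of_fderiv_snd {F N h : ℝ × ℝ → E3} {W : Set (ℝ × ℝ)}
    (hF : IsFrontalWith F N W) (hW : IsOpen W) (hh : ContDiffOn ℝ ∞ h W)
    (hv : ∀ y ∈ W, fderiv ℝ F y (0, 1) = y.2 • h y) {y : ℝ × ℝ} (hy : y ∈ W) :
    ⟪h y, N y⟫_ℝ = 0 := by
  have off (z : ℝ × ℝ) (hz : z ∈ W) (hz0 : z.2 ≠ 0) : ⟪h z, N z⟫_ℝ = 0 := by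
    have := hF.perp z hz (0, 1)
    rw [hv z hz, real_inner_smul_left] at this
    exact (mul_eq_zero.1 this).resolve_left hz0
  by_cases hy0 : y.2 = 0
  · have hc : ContinuousAt (fun z => ⟪h z, N z⟫_ℝ) y :=
      (hh.inner ℝ hF.smooth_normal).continuousOn.continuousAt (hW.mem_nhds hy)
    refine eq_zero_of_eventually_punctured (g := fun v => ⟪h (y.1, v), N (y.1, v)⟫_ℝ)
      (a := y.2) (ContinuousAt.comp (f := fun v : ℝ => (y.1, v)) hc continuousAt_snd_line) ?_
    filter_upwards [nhdsWithin_le_nhds (continuousAt_snd_line (hW.mem_nhds hy)),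
      self_mem_nhdsWithin] with v hvW hv0
    exact off _ hvW (by simpa [hy0] using hv0)
  · exact off y hy hy0

/-- Coordinates `(u, v)` in which the singular set is `v = 0`, the null direction is `∂_v`,
and `f_v = v h` with `f_u`, `h` linearly independent; moreover `⟪h_v, ν⟫ ≠ 0` at the singular
points with `u ≠ 0`. -/
structure IsAdapted (F N h : ℝ × ℝ → E3) (W : Set (ℝ × ℝ)) : Prop where
  isOpen : IsOpen W
  frontal : IsFrontalWith F N W
  smooth : ContDiffOn ℝ ∞ h W
  fderiv_snd : ∀ y ∈ W, fderiv ℝ F y (0, 1) = y.2 • h y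
  gram_pos : ∀ y ∈ W, 0 < ⟪fderiv ℝ F y (1, 0), fderiv ℝ F y (1, 0)⟫_ℝ * ⟪h y, h y⟫_ℝ
    - ⟪fderiv ℝ F y (1, 0), h y⟫_ℝ ^ 2
  inner_ne : ∀ u : ℝ, u ≠ 0 → ((u, 0) : ℝ × ℝ) ∈ W →
    ⟪fderiv ℝ h (u, 0) (0, 1), N (u, 0)⟫_ℝ ≠ 0

namespace IsAdapted

variable {F N h : ℝ × ℝ → E3} {W : Set (ℝ × ℝ)}

/-- The density `det (f_u, h, ν)`, where `f_v = v h`. -/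
noncomputable def reducedDensity (F N h : ℝ × ℝ → E3) (y : ℝ × ℝ) : ℝ :=
  det3 (fderiv ℝ F y (1, 0)) (h y) (N y)

/-- The coefficient `- ⟪h, ν_v⟫`. -/
noncomputable def coeffN (N h : ℝ × ℝ → E3) (y : ℝ × ℝ) : ℝ := - ⟪h y, fderiv ℝ N y (0, 1)⟫_ℝ

/-- The coefficient `- ⟪h, ν_u⟫`. -/
noncomputable def coeffM (N h : ℝ × ℝ → E3) (y : ℝ × ℝ) : ℝ := - ⟪h y, fderiv ℝ N y (1, 0)⟫_ℝ

/-- The coefficient `- ⟪f_u, ν_u⟫` of the second fundamental form. -/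
noncomputable def coeffL (F N : ℝ × ℝ → E3) (y : ℝ × ℝ) : ℝ := secondForm F N y (1, 0) (1, 0)

/-- The determinant `det (f_u, f_uu, ν)`. -/
noncomputable def lineDet (F N : ℝ × ℝ → E3) (y : ℝ × ℝ) : ℝ :=
  det3 (fderiv ℝ F y (1, 0)) (fderiv ℝ (fun z => fderiv ℝ F z (1, 0)) y (1, 0)) (N y)

lemma contDiffOn_det3 {a b c : ℝ × ℝ → E3} (ha : ContDiffOn ℝ ∞ a W) (hb : ContDiffOn ℝ ∞ b W)
    (hc : ContDiffOn ℝ ∞ c W) : ContDiffOn ℝ ∞ (fun y => det3 (a y) (b y) (c y)) W := by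
  have ha' (i : Fin 3) : ContDiffOn ℝ ∞ (fun y => a y i) W := contDiffOn_euclidean.1 ha i
  have hb' (i : Fin 3) : ContDiffOn ℝ ∞ (fun y => b y i) W := contDiffOn_euclidean.1 hb i
  have hc' (i : Fin 3) : ContDiffOn ℝ ∞ (fun y => c y i) W := contDiffOn_euclidean.1 hc i
  simp only [det3_eq]
  fun_prop

variable (H : IsAdapted F N h W)
include H

lemma contDiffOn_reducedDensity : ContDiffOn ℝ ∞ (reducedDensity F N h) W :=
  contDiffOn_det3 (contDiffOn_fderiv_apply H.isOpen H.frontal.smooth _) H.smooth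
    H.frontal.smooth_normal

lemma contDiffOn_coeffN : ContDiffOn ℝ ∞ (coeffN N h) W :=
  (H.smooth.inner ℝ (contDiffOn_fderiv_apply H.isOpen H.frontal.smooth_normal _)).neg

lemma contDiffOn_coeffM : ContDiffOn ℝ ∞ (coeffM N h) W :=
  (H.smooth.inner ℝ (contDiffOn_fderiv_apply H.isOpen H.frontal.smooth_normal _)).neg

lemma contDiffOn_coeffL : ContDiffOn ℝ ∞ (coeffL F N) W :=
  ((contDiffOn_fderiv_apply H.isOpen H.frontal.smooth _).inner ℝ
    (contDiffOn_fderiv_apply H.isOpen H.frontal.smooth_normal _)).neg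

lemma contDiffOn_lineDet : ContDiffOn ℝ ∞ (lineDet F N) W :=
  contDiffOn_det3 (contDiffOn_fderiv_apply H.isOpen H.frontal.smooth _)
    (contDiffOn_fderiv_apply H.isOpen (contDiffOn_fderiv_apply H.isOpen H.frontal.smooth _) _)
    H.frontal.smooth_normal

lemma inner_normal {y : ℝ × ℝ} (hy : y ∈ W) : ⟪h y, N y⟫_ℝ = 0 :=
  H.frontal.inner_normal_of_fderiv_snd H.isOpen H.smooth H.fderiv_snd hy

lemma reducedDensity_sq {y : ℝ × ℝ} (hy : y ∈ W) : reducedDensity F N h y ^ 2 =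
    ⟪fderiv ℝ F y (1, 0), fderiv ℝ F y (1, 0)⟫_ℝ * ⟪h y, h y⟫_ℝ
      - ⟪fderiv ℝ F y (1, 0), h y⟫_ℝ ^ 2 :=
  det3_sq_of_unit_normal (H.frontal.perp y hy _) (H.inner_normal hy) (H.frontal.unit y hy)

lemma reducedDensity_ne_zero {y : ℝ × ℝ} (hy : y ∈ W) : reducedDensity F N h y ≠ 0 := by
  have := H.gram_pos y hy
  rw [← H.reducedDensity_sq hy] at this
  exact fun h0 => by simp [h0] at this

lemma areaDensity_eq {y : ℝ × ℝ} (hy : y ∈ W) :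
    areaDensity F N y = y.2 * reducedDensity F N h y := by
  simp only [areaDensity, H.fderiv_snd y hy, reducedDensity, det3_eq, PiLp.smul_apply, smul_eq_mul]
  ring

lemma isSingularPt_iff {y : ℝ × ℝ} (hy : y ∈ W) : IsSingularPt F N y ↔ y.2 = 0 := by
  simp [IsSingularPt, H.areaDensity_eq hy, H.reducedDensity_ne_zero hy]

/-- By symmetry the derivative `∂_v` can be moved onto `F`, where it produces the factor `v`. Hence
every coefficient of the second fundamental form except `L` is divisible by `v`. -/
lemma inner_fderiv_fst_normal {y : ℝ × ℝ} (hy : y ∈ W) (X : ℝ × ℝ) :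
    ⟪fderiv ℝ F y X, fderiv ℝ N y (0, 1)⟫_ℝ = y.2 * ⟪h y, fderiv ℝ N y X⟫_ℝ := by
  rw [H.frontal.inner_fderiv_normal_symm H.isOpen hy, H.fderiv_snd y hy, real_inner_smul_left]

/-- The first form has determinant `v² μ²`, the second `v L n - v² m²`. One factor `v` cancels,
leaving an identity whose right side is smooth across the axis. -/
lemma gaussCurvature_mul {y : ℝ × ℝ} (hy : y ∈ W) (hy0 : y.2 ≠ 0) :
    gaussCurvature F N y * (y.2 * reducedDensity F N h y ^ 2) =
      coeffL F N y * coeffN N h y - y.2 * coeffM N h y ^ 2 := by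
  have hD := H.gram_pos y hy
  rw [H.reducedDensity_sq hy]
  simp only [gaussCurvature, secondForm, firstForm, coeffL, coeffN, coeffM,
    H.inner_fderiv_fst_normal hy]
  rw [H.fderiv_snd y hy]
  simp only [real_inner_smul_left, real_inner_smul_right]
  set D := ⟪fderiv ℝ F y (1, 0), fderiv ℝ F y (1, 0)⟫_ℝ * ⟪h y, h y⟫_ℝ
    - ⟪fderiv ℝ F y (1, 0), h y⟫_ℝ ^ 2 with hDdef
  have e : ⟪fderiv ℝ F y (1, 0), fderiv ℝ F y (1, 0)⟫_ℝ * (y.2 * (y.2 * ⟪h y, h y⟫_ℝ))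
      - (y.2 * ⟪fderiv ℝ F y (1, 0), h y⟫_ℝ) ^ 2 = y.2 ^ 2 * D := by
    rw [hDdef]; ring
  rw [e, div_mul_eq_mul_div, div_eq_iff (by positivity)]
  ring

lemma secondForm_of_snd_eq_zero {y : ℝ × ℝ} (hy : y ∈ W) (hy0 : y.2 = 0) (X Y : ℝ × ℝ) :
    secondForm F N y X Y = X.1 * Y.1 * coeffL F N y := by
  rw [secondForm_eq]
  simp only [coeffL, secondForm, H.inner_fderiv_fst_normal hy, H.fderiv_snd y hy, hy0]
  simp

/-- This is the `v`-derivative of `⟪h, N⟫ = 0`; it links `n` to the nonvanishing condition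
`inner_ne`. -/
lemma coeffN_eq {y : ℝ × ℝ} (hy : y ∈ W) : coeffN N h y = ⟪fderiv ℝ h y (0, 1), N y⟫_ℝ := by
  have := inner_fderiv_add_eq_zero H.isOpen hy (differentiableAt_of_smooth H.isOpen H.smooth hy)
    (differentiableAt_of_smooth H.isOpen H.frontal.smooth_normal hy)
    (fun z hz => H.inner_normal hz) (0, 1)
  rw [coeffN]
  linarith

lemma fderiv_fst_snd_eq_zero {y : ℝ × ℝ} (hy : y ∈ W) (hy0 : y.2 = 0) :
    fderiv ℝ (fun z => fderiv ℝ F z (1, 0)) y (0, 1) = 0 := by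
  rw [fderiv_fderiv_apply_comm H.isOpen H.frontal.smooth hy]
  have : (fun z => fderiv ℝ F z (0, 1)) =ᶠ[𝓝 y] fun z => z.2 • h z := by
    filter_upwards [H.isOpen.mem_nhds hy] with z hz using H.fderiv_snd z hz
  rw [this.fderiv_eq, fderiv_fun_smul (by fun_prop)
    (differentiableAt_of_smooth H.isOpen H.smooth hy)]
  simp [hy0, _root_.fderiv_snd]

/-- On the singular set, `L_v = ⟪f_uu, ν_v⟫`. -/
lemma fderiv_coeffL {y : ℝ × ℝ} (hy : y ∈ W) (hy0 : y.2 = 0) :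
    fderiv ℝ (coeffL F N) y (0, 1) =
      ⟪fderiv ℝ (fun z => fderiv ℝ F z (1, 0)) y (1, 0), fderiv ℝ N y (0, 1)⟫_ℝ := by
  have dF (X) := differentiableAt_of_smooth H.isOpen
    (contDiffOn_fderiv_apply H.isOpen H.frontal.smooth X) hy
  have dN (X) := differentiableAt_of_smooth H.isOpen
    (contDiffOn_fderiv_apply H.isOpen H.frontal.smooth_normal X) hy
  have dh := differentiableAt_of_smooth H.isOpen H.smooth hy
  -- The function `⟪F_u, N_v⟫ = v ⟪h, N_u⟫` vanishes along the axis, so its `u`-derivative does too.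
  -- This trades `⟪F_u, N_uv⟫` for `-⟪F_uu, N_v⟫`.
  have e1 : fderiv ℝ (fun z => ⟪fderiv ℝ F z (1, 0), fderiv ℝ N z (0, 1)⟫_ℝ) y (1, 0) = 0 := by
    have : (fun z => ⟪fderiv ℝ F z (1, 0), fderiv ℝ N z (0, 1)⟫_ℝ) =ᶠ[𝓝 y]
        fun z => z.2 * ⟪h z, fderiv ℝ N z (1, 0)⟫_ℝ := by
      filter_upwards [H.isOpen.mem_nhds hy] with z hz using H.inner_fderiv_fst_normal hz _
    rw [this.fderiv_eq, fderiv_fun_mul (by fun_prop) (dh.inner ℝ (dN _))]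
    simp [hy0, _root_.fderiv_snd]
  rw [fderiv_inner_apply ℝ (dF _) (dN _)] at e1
  have e2 : fderiv ℝ (coeffL F N) y (0, 1) =
      - fderiv ℝ (fun z => ⟪fderiv ℝ F z (1, 0), fderiv ℝ N z (1, 0)⟫_ℝ) y (0, 1) := by
    rw [show coeffL F N = fun z => -⟪fderiv ℝ F z (1, 0), fderiv ℝ N z (1, 0)⟫_ℝ from rfl,
      fderiv_fun_neg]
    rfl
  rw [e2, fderiv_inner_apply ℝ (dF _) (dN _), H.fderiv_fst_snd_eq_zero hy hy0,
    fderiv_fderiv_apply_comm H.isOpen H.frontal.smooth_normal hy, inner_zero_left]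
  linarith

/-- Expand `F_uu` in the frame `F_u, h, N` by Cramer's rule and pair with `N_v`. On the axis `N_v`
is orthogonal to `F_u` and to `N`, so only the `h` term survives. -/
lemma fderiv_coeffL_mul {y : ℝ × ℝ} (hy : y ∈ W) (hy0 : y.2 = 0) :
    fderiv ℝ (coeffL F N) y (0, 1) * reducedDensity F N h y =
      - (coeffN N h y * lineDet F N y) := by
  have := det3_mul_inner (fderiv ℝ F y (1, 0)) (h y) (N y)
    (fderiv ℝ (fun z => fderiv ℝ F z (1, 0)) y (1, 0)) (fderiv ℝ N y (0, 1))
  rw [H.inner_fderiv_fst_normal hy, hy0,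
    H.frontal.inner_normal_fderiv_normal H.isOpen hy] at this
  rw [H.fderiv_coeffL hy hy0, reducedDensity, coeffN, lineDet]
  linarith

/-! ### The curvature near the singular set -/

/-- The factor `n` can be cancelled except at `u = 0`; there `L` vanishes by continuity, as `S` is
open and contains nearby nonzero points. -/
lemma coeffL_eq_zero_of_mul {S : Set ℝ} (hS : IsOpen S)
    (hSW : ∀ u ∈ S, ((u, 0) : ℝ × ℝ) ∈ W)
    (h0 : ∀ u ∈ S, coeffL F N (u, 0) * coeffN N h (u, 0) = 0) :
    ∀ u ∈ S, coeffL F N (u, 0) = 0 := by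
  have off (u) (hu : u ∈ S) (hu0 : u ≠ 0) : coeffL F N (u, 0) = 0 := by
    refine (mul_eq_zero.1 (h0 u hu)).resolve_right ?_
    rw [H.coeffN_eq (hSW u hu)]
    exact H.inner_ne u hu0 (hSW u hu)
  intro u hu
  by_cases hu0 : u = 0
  · subst hu0
    refine eq_zero_of_eventually_punctured (g := fun u => coeffL F N (u, 0)) (a := 0)
      (ContinuousAt.comp (f := fun u : ℝ => ((u, 0) : ℝ × ℝ))
        (H.contDiffOn_coeffL.continuousOn.continuousAt (H.isOpen.mem_nhds (hSW 0 hu)))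
        (by fun_prop)) ?_
    filter_upwards [nhdsWithin_le_nhds (hS.mem_nhds hu), self_mem_nhdsWithin] with v hv hv0
    exact off v hv hv0
  · exact off u hu hu0

/-- Let `v → 0` in `|L n - v m²| ≤ C |v| μ²`. -/
lemma coeff_mul_eq_zero_of_bounded {u C : ℝ} (hu : ((u, 0) : ℝ × ℝ) ∈ W)
    (hC : ∀ᶠ y in 𝓝 ((u, 0) : ℝ × ℝ), y.2 ≠ 0 → |gaussCurvature F N y| ≤ C) :
    coeffL F N (u, 0) * coeffN N h (u, 0) = 0 := by
  have hl : ContinuousAt (fun v : ℝ => ((u, v) : ℝ × ℝ)) 0 := by fun_prop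
  have hn := H.isOpen.mem_nhds hu
  have c {g : ℝ × ℝ → ℝ} (hg : ContDiffOn ℝ ∞ g W) : ContinuousAt (fun v : ℝ => g (u, v)) 0 :=
    ContinuousAt.comp (f := fun v : ℝ => (u, v)) (hg.continuousOn.continuousAt hn) hl
  have cL := c H.contDiffOn_coeffL
  have cN := c H.contDiffOn_coeffN
  have cM := c H.contDiffOn_coeffM
  have cD := c H.contDiffOn_reducedDensity
  have key := nonpos_of_eventually_punctured (a := 0)
    (g := fun v : ℝ => |coeffL F N (u, v) * coeffN N h (u, v) - v * coeffM N h (u, v) ^ 2|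
      - C * (|v| * reducedDensity F N h (u, v) ^ 2)) (by fun_prop) (by
    filter_upwards [nhdsWithin_le_nhds (hl (H.isOpen.mem_nhds hu)),
      nhdsWithin_le_nhds (hl hC), self_mem_nhdsWithin] with v hvW hvC hv0
    have hK := H.gaussCurvature_mul hvW hv0
    have hb := hvC hv0
    simp only at hK
    rw [← hK, abs_mul, abs_mul, abs_of_nonneg (sq_nonneg (reducedDensity F N h (u, v)))]
    rw [sub_nonpos]
    gcongr)
  exact abs_nonpos_iff.1 (by simpa [abs_mul] using key)

/-- A Lipschitz bound gives `|L| ≤ k |v|` above a zero of `L` on the axis, so `|v|` cancels from the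
curvature identity. Only the foot `(y.1, 0)` must be a zero, so the ball and the bound serve all `δ`
at once. -/
lemma exists_ball_curvature_bounded (h0 : (0 : ℝ × ℝ) ∈ W) :
    ∃ r > 0, Metric.ball (0 : ℝ × ℝ) r ⊆ W ∧ ∃ C : ℝ, ∀ y ∈ Metric.ball (0 : ℝ × ℝ) r,
      y.2 ≠ 0 → coeffL F N (y.1, 0) = 0 → |gaussCurvature F N y| ≤ C := by
  have hn := H.isOpen.mem_nhds h0
  have c {g : ℝ × ℝ → ℝ} (hg : ContDiffOn ℝ ∞ g W) : ContinuousAt g 0 :=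
    hg.continuousOn.continuousAt hn
  obtain ⟨k, t, ht, hk⟩ := ((H.contDiffOn_coeffL.contDiffAt hn).of_le
    (by simp : (1 : WithTop ℕ∞) ≤ ∞)).exists_lipschitzOnWith
  have eN : ∀ᶠ y in 𝓝 (0 : ℝ × ℝ), |coeffN N h y| < |coeffN N h 0| + 1 :=
    (c H.contDiffOn_coeffN).abs.eventually_lt continuousAt_const (by simp)
  have eM : ∀ᶠ y in 𝓝 (0 : ℝ × ℝ), coeffM N h y ^ 2 < coeffM N h 0 ^ 2 + 1 :=
    ((c H.contDiffOn_coeffM).pow 2).eventually_lt continuousAt_const (by simp)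
  have hD0 : 0 < reducedDensity F N h 0 ^ 2 := by
    have := H.reducedDensity_ne_zero h0
    positivity
  have eD : ∀ᶠ y in 𝓝 (0 : ℝ × ℝ), reducedDensity F N h 0 ^ 2 / 2 < reducedDensity F N h y ^ 2 :=
    continuousAt_const.eventually_lt ((c H.contDiffOn_reducedDensity).pow 2) (half_lt_self hD0)
  obtain ⟨r, hr, hball⟩ := Metric.eventually_nhds_iff_ball.1
    (eN.and (eM.and (eD.and ((H.isOpen.eventually_mem h0).and (Filter.eventually_mem_set.2 ht)))))
  refine ⟨r, hr, fun y hy => (hball y hy).2.2.2.1,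
    (k * (|coeffN N h 0| + 1) + (coeffM N h 0 ^ 2 + 1)) / (reducedDensity F N h 0 ^ 2 / 2), ?_⟩
  intro y hy hy0 hL
  obtain ⟨hN, hM, hD, hW, hyt⟩ := hball y hy
  -- The norm on the product is the maximum norm, so projecting to the axis stays in the ball.
  have hy' : ((y.1, 0) : ℝ × ℝ) ∈ Metric.ball (0 : ℝ × ℝ) r := by
    rw [mem_ball_zero_iff, Prod.norm_def] at hy ⊢
    simp only [norm_zero]
    exact lt_of_le_of_lt (max_le_max le_rfl (norm_nonneg _)) hy
  have hLip : |coeffL F N y| ≤ k * |y.2| := by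
    have := hk.dist_le_mul y hyt (y.1, 0) (hball _ hy').2.2.2.2
    rw [hL, Real.dist_eq, sub_zero, Prod.dist_eq] at this
    simpa using this
  have hK := congrArg abs (H.gaussCurvature_mul hW hy0)
  rw [abs_mul, abs_mul, abs_of_nonneg (sq_nonneg (reducedDensity F N h y))] at hK
  have hv : 0 < |y.2| := abs_pos.2 hy0
  have hup : |coeffL F N y * coeffN N h y - y.2 * coeffM N h y ^ 2| ≤
      |y.2| * (k * (|coeffN N h 0| + 1) + (coeffM N h 0 ^ 2 + 1)) := by
    calc _ ≤ |coeffL F N y * coeffN N h y| + |y.2 * coeffM N h y ^ 2| := abs_sub _ _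
      _ = |coeffL F N y| * |coeffN N h y| + |y.2| * coeffM N h y ^ 2 := by
          rw [abs_mul, abs_mul, abs_of_nonneg (sq_nonneg (coeffM N h y))]
      _ ≤ k * |y.2| * (|coeffN N h 0| + 1) + |y.2| * (coeffM N h 0 ^ 2 + 1) := by gcongr
      _ = _ := by ring
  rw [← hK] at hup
  have hlow : |gaussCurvature F N y| * (|y.2| * (reducedDensity F N h 0 ^ 2 / 2)) ≤
      |gaussCurvature F N y| * (|y.2| * reducedDensity F N h y ^ 2) := by gcongr
  rw [le_div_iff₀ (by positivity)]
  refine le_of_mul_le_mul_left ?_ hv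
  linarith

/-- Multiplied by `v`, the curvature identity reads `v L n = K (v μ)² + (v m)²`. -/
lemma mul_coeff_nonneg {y : ℝ × ℝ} (hy : y ∈ W)
    (hK : y.2 ≠ 0 → 0 ≤ gaussCurvature F N y) :
    0 ≤ y.2 * (coeffL F N y * coeffN N h y) := by
  by_cases hy0 : y.2 = 0
  · simp [hy0]
  · have e : y.2 * (coeffL F N y * coeffN N h y) = gaussCurvature F N y *
        (y.2 * reducedDensity F N h y) ^ 2 + (y.2 * coeffM N h y) ^ 2 := by
      linear_combination - y.2 * H.gaussCurvature_mul hy hy0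
    have := hK hy0
    rw [e]
    positivity

lemma lineDet_mul_nonpos_of_curvature_nonneg {V : Set (ℝ × ℝ)} (hV : IsOpen V) (hVW : V ⊆ W)
    (hK : ∀ y ∈ V, y.2 ≠ 0 → 0 ≤ gaussCurvature F N y) {u : ℝ} (hu : ((u, 0) : ℝ × ℝ) ∈ V) :
    lineDet F N (u, 0) * reducedDensity F N h (u, 0) ≤ 0 := by
  have hl (u : ℝ) : ContinuousAt (fun v : ℝ => ((u, v) : ℝ × ℝ)) 0 := by fun_prop
  have hS : IsOpen {u : ℝ | ((u, 0) : ℝ × ℝ) ∈ V} := hV.preimage (by fun_prop)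
  have hev (u : ℝ) (hu : ((u, 0) : ℝ × ℝ) ∈ V) :
      ∀ᶠ v in 𝓝 (0 : ℝ), 0 ≤ v * (coeffL F N (u, v) * coeffN N h (u, v)) := by
    filter_upwards [hl u (hV.mem_nhds hu)] with v hv
    exact H.mul_coeff_nonneg (hVW hv) (hK _ hv)
  have hd (u : ℝ) (hu : ((u, 0) : ℝ × ℝ) ∈ V) {g : ℝ × ℝ → ℝ} (hg : ContDiffOn ℝ ∞ g W) :
      HasDerivAt (fun v : ℝ => g (u, v)) (fderiv ℝ g (u, 0) (0, 1)) 0 :=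
    (differentiableAt_of_smooth H.isOpen hg (hVW hu)).hasFDerivAt.comp_hasDerivAt (0 : ℝ)
      ((hasDerivAt_const (0 : ℝ) u).prodMk (hasDerivAt_id (0 : ℝ)))
  have hmul (u : ℝ) (hu : ((u, 0) : ℝ × ℝ) ∈ V) :=
    (hd u hu H.contDiffOn_coeffL).mul (hd u hu H.contDiffOn_coeffN)
  have hL := H.coeffL_eq_zero_of_mul hS (fun u hu => hVW hu)
    (fun u hu => eq_zero_of_mul_self_nonneg (hmul u hu).continuousAt (hev u hu))
  have off (u : ℝ) (hu : ((u, 0) : ℝ × ℝ) ∈ V) (hu0 : u ≠ 0) :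
      lineDet F N (u, 0) * reducedDensity F N h (u, 0) ≤ 0 := by
    have h1 := deriv_nonneg_of_mul_self_nonneg (hmul u hu) (hev u hu)
    -- Since `L = 0` on the axis, the product rule for `L n` leaves only `L_v n`.
    rw [hL u hu, zero_mul, add_zero] at h1
    have h2 := H.fderiv_coeffL_mul (hVW hu) rfl
    have hn : coeffN N h (u, 0) ≠ 0 := by
      rw [H.coeffN_eq (hVW hu)]
      exact H.inner_ne u hu0 (hVW hu)
    have hpos : 0 < coeffN N h (u, 0) ^ 2 := by positivity
    refine nonpos_of_mul_nonpos_right (b := lineDet F N (u, 0) * reducedDensity F N h (u, 0))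
      ?_ hpos
    have e : coeffN N h (u, 0) ^ 2 * (lineDet F N (u, 0) * reducedDensity F N h (u, 0)) =
        -(reducedDensity F N h (u, 0) ^ 2 *
          (fderiv ℝ (coeffL F N) (u, 0) (0, 1) * coeffN N h (u, 0))) := by
      linear_combination coeffN N h (u, 0) * reducedDensity F N h (u, 0) * h2
    rw [e]
    have := mul_nonneg (sq_nonneg (reducedDensity F N h (u, 0))) h1
    linarith
  by_cases hu0 : u = 0
  · subst hu0
    have hc := (H.contDiffOn_lineDet.mul H.contDiffOn_reducedDensity).continuousOn.continuousAt
      (H.isOpen.mem_nhds (hVW hu))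
    refine nonpos_of_eventually_punctured (a := 0)
      (g := fun u => lineDet F N (u, 0) * reducedDensity F N h (u, 0))
      (ContinuousAt.comp (f := fun u : ℝ => ((u, 0) : ℝ × ℝ)) hc (by fun_prop)) ?_
    filter_upwards [nhdsWithin_le_nhds (hS.mem_nhds hu), self_mem_nhdsWithin] with v hv hv0
    exact off v hv hv0
  · exact off u hu hu0

end IsAdapted

/-! ### Adapted coordinates at a cuspidal cross cap -/

lemma fderiv_symm_comp_fderiv {E : Type*} [NormedAddCommGroup E] [NormedSpace ℝ E]
    (e : OpenPartialHomeomorph E E) (he : ContDiffOn ℝ ∞ e e.source)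
    (he' : ContDiffOn ℝ ∞ e.symm e.target) {x : E} (hx : x ∈ e.source) :
    (fderiv ℝ e.symm (e x)).comp (fderiv ℝ e x) = ContinuousLinearMap.id ℝ E := by
  have h1 : DifferentiableAt ℝ e x :=
    (he.contDiffAt (e.open_source.mem_nhds hx)).differentiableAt (by simp)
  have h2 : DifferentiableAt ℝ e.symm (e x) :=
    (he'.contDiffAt (e.open_target.mem_nhds (e.map_source hx))).differentiableAt (by simp)
  have h3 : e.symm ∘ e =ᶠ[𝓝 x] id := e.eventually_left_inverse hx
  rw [← fderiv_comp x h2 h1, h3.fderiv_eq, fderiv_id]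

/-- A chart of the source in which the frontal `f` is adapted. -/
structure IsAdaptedChart (f ν : ℝ × ℝ → E3) (U : Set (ℝ × ℝ))
    (φ : OpenPartialHomeomorph (ℝ × ℝ) (ℝ × ℝ)) (h : ℝ × ℝ → E3) : Prop where
  isOpen : IsOpen U
  frontal : IsFrontalWith f ν U
  smooth : ContDiffOn ℝ ∞ φ φ.source
  smooth_symm : ContDiffOn ℝ ∞ φ.symm φ.target
  source_subset : φ.source ⊆ U
  adapted : IsAdapted (f ∘ φ.symm) (ν ∘ φ.symm) h φ.target

lemma fderiv_eq_of_components {g : ℝ × ℝ → E3} {y X : ℝ × ℝ} {w : E3}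
    {g' : Fin 3 → ℝ × ℝ →L[ℝ] ℝ} (hg : ∀ i, HasFDerivAt (fun z => g z i) (g' i) y)
    (hw : ∀ i, g' i X = w i) : DifferentiableAt ℝ g y ∧ fderiv ℝ g y X = w := by
  have hd : DifferentiableAt ℝ g y := differentiableAt_euclidean.2 fun i =>
    (hg i).differentiableAt
  refine ⟨hd, ?_⟩
  ext i
  have h1 : HasFDerivAt (fun z => g z i) ((EuclideanSpace.proj i : E3 →L[ℝ] ℝ).comp (fderiv ℝ g y))
      y :=
    (EuclideanSpace.proj i : E3 →L[ℝ] ℝ).hasFDerivAt.comp y hd.hasFDerivAt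
  rw [← hw i, ← h1.unique (hg i)]
  rfl

lemma contDiff_stdCuspidalCrossCap : ContDiff ℝ ∞ stdCuspidalCrossCap := by
  refine contDiff_euclidean.2 fun i => ?_
  fin_cases i <;> simp [stdCuspidalCrossCap] <;> fun_prop

lemma fderiv_stdCuspidalCrossCap (y X : ℝ × ℝ) : fderiv ℝ stdCuspidalCrossCap y X =
    !₂[X.1, 2 * y.2 * X.2, X.1 * y.2 ^ 3 + 3 * y.1 * y.2 ^ 2 * X.2] := by
  have h1 : HasFDerivAt (fun z : ℝ × ℝ => z.1) (ContinuousLinearMap.fst ℝ ℝ ℝ) y := hasFDerivAt_fst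
  have h2 : HasFDerivAt (fun z : ℝ × ℝ => z.2) (ContinuousLinearMap.snd ℝ ℝ ℝ) y := hasFDerivAt_snd
  refine (fderiv_eq_of_components (g' := ![ContinuousLinearMap.fst ℝ ℝ ℝ,
    (2 * y.2) • ContinuousLinearMap.snd ℝ ℝ ℝ,
    y.1 • ((3 * y.2 ^ 2) • ContinuousLinearMap.snd ℝ ℝ ℝ)
      + y.2 ^ 3 • ContinuousLinearMap.fst ℝ ℝ ℝ]) (fun i => ?_) (fun i => ?_)).2
  · fin_cases i
    · simpa [stdCuspidalCrossCap] using h1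
    · simpa [stdCuspidalCrossCap] using h2.pow 2
    · simpa [stdCuspidalCrossCap] using h1.fun_mul (h2.pow 3)
  · fin_cases i <;> simp
    ring

/-- The vector field `g_v / v` along the standard cuspidal cross cap `g`. -/
noncomputable def stdReduced (y : ℝ × ℝ) : E3 := !₂[0, 2, 3 * y.1 * y.2]

lemma contDiff_stdReduced : ContDiff ℝ ∞ stdReduced := by
  refine contDiff_euclidean.2 fun i => ?_
  fin_cases i <;> simp [stdReduced] <;> fun_prop

lemma fderiv_stdReduced (u : ℝ) : fderiv ℝ stdReduced (u, 0) (0, 1) = !₂[0, 0, 3 * u] := by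
  have h1 : HasFDerivAt (fun z : ℝ × ℝ => z.1) (ContinuousLinearMap.fst ℝ ℝ ℝ) (u, 0) :=
    hasFDerivAt_fst
  have h2 : HasFDerivAt (fun z : ℝ × ℝ => z.2) (ContinuousLinearMap.snd ℝ ℝ ℝ) (u, 0) :=
    hasFDerivAt_snd
  refine (fderiv_eq_of_components (g' := ![0, 0, (3 * u) • ContinuousLinearMap.snd ℝ ℝ ℝ])
    (fun i => ?_) (fun i => ?_)).2
  · fin_cases i
    · simpa [stdReduced] using hasFDerivAt_const (0 : ℝ) ((u, 0) : ℝ × ℝ)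
    · simpa [stdReduced] using hasFDerivAt_const (2 : ℝ) ((u, 0) : ℝ × ℝ)
    · simpa [stdReduced] using (h1.const_mul 3).fun_mul h2
  · fin_cases i <;> simp

variable {p : ℝ × ℝ}

lemma IsFrontalWith.comp_symm (hf : IsFrontalWith f ν U) (hU : IsOpen U)
    {φ : OpenPartialHomeomorph (ℝ × ℝ) (ℝ × ℝ)} (hφ : ContDiffOn ℝ ∞ φ.symm φ.target)
    (hs : φ.source ⊆ U) : IsFrontalWith (f ∘ φ.symm) (ν ∘ φ.symm) φ.target := by
  have hm : MapsTo φ.symm φ.target U := fun y hy => hs (φ.map_target hy)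
  refine ⟨hf.smooth.comp hφ hm, hf.smooth_normal.comp hφ hm, fun y hy => hf.unit _ (hm hy),
    fun y hy X => ?_⟩
  rw [fderiv_comp_apply' (differentiableAt_of_smooth φ.open_target hφ hy)
    (differentiableAt_of_smooth hU hf.smooth (hm hy))]
  exact hf.perp _ (hm hy) _

/-- With `g` the standard model, `f ∘ φ⁻¹ = Φ⁻¹ ∘ g`, and `h` is the image of `g_v / v` under
`dΦ⁻¹`. Independence and nonvanishing pass from the model because `dΦ⁻¹` is invertible. -/
lemma IsCuspidalCrossCap.exists_adaptedChart (hU : IsOpen U) (hf : IsFrontalWith f ν U)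
    (hp : IsCuspidalCrossCap f U p) : ∃ (φ : OpenPartialHomeomorph (ℝ × ℝ) (ℝ × ℝ))
      (h : ℝ × ℝ → E3), p ∈ φ.source ∧ φ p = 0 ∧ IsAdaptedChart f ν U φ h := by
  obtain ⟨φ, Φ, hφ, hφ', hΦ, hΦ', hpφ, hsU, hφp, hmaps, heq⟩ := hp
  have hfr := hf.comp_symm hU hφ' hsU
  have hmem (y) (hy : y ∈ φ.target) : stdCuspidalCrossCap y ∈ Φ.target := by
    have := Φ.map_source (hmaps (φ.map_target hy))
    rwa [heq _ (φ.map_target hy), φ.right_inv hy] at this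
  have hF (y) (hy : y ∈ φ.target) :
      (f ∘ φ.symm) y = (Φ.symm ∘ stdCuspidalCrossCap) y := by
    have := Φ.left_inv (hmaps (φ.map_target hy))
    rw [heq _ (φ.map_target hy), φ.right_inv hy] at this
    exact this.symm
  have hdΨ (z) (hz : z ∈ Φ.target) : DifferentiableAt ℝ Φ.symm z :=
    (hΦ'.contDiffAt (Φ.open_target.mem_nhds hz)).differentiableAt (by simp)
  have hdg (y) : DifferentiableAt ℝ stdCuspidalCrossCap y :=
    contDiff_stdCuspidalCrossCap.differentiable (by simp) y
  have hdF (y) (hy : y ∈ φ.target) (X : ℝ × ℝ) : fderiv ℝ (f ∘ φ.symm) y X =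
      fderiv ℝ Φ.symm (stdCuspidalCrossCap y) (fderiv ℝ stdCuspidalCrossCap y X) := by
    have : f ∘ φ.symm =ᶠ[𝓝 y] Φ.symm ∘ stdCuspidalCrossCap := by
      filter_upwards [φ.open_target.mem_nhds hy] with z hz using hF z hz
    rw [this.fderiv_eq, fderiv_comp y (hdΨ _ (hmem y hy)) (hdg y)]
    rfl
  have hinj (z) (hz : z ∈ Φ.target) (w : E3) (hw : fderiv ℝ Φ.symm z w = 0) : w = 0 := by
    have := DFunLike.congr_fun (fderiv_symm_comp_fderiv Φ.symm hΦ' hΦ hz) w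
    simpa [hw] using this.symm
  have hsurj (z) (hz : z ∈ Φ.target) (w : E3) : ∃ w', fderiv ℝ Φ.symm z w' = w := by
    have := DFunLike.congr_fun (fderiv_symm_comp_fderiv Φ hΦ hΦ' (Φ.map_target hz)) w
    rw [Φ.right_inv hz] at this
    exact ⟨_, this⟩
  have hfdΨ : ContDiffOn ℝ ∞ (fderiv ℝ Φ.symm) Φ.target :=
    hΦ'.fderiv_of_isOpen Φ.open_target (by simp)
  have hc : ContDiffOn ℝ ∞ (fun y => fderiv ℝ Φ.symm (stdCuspidalCrossCap y)) φ.target :=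
    hfdΨ.comp contDiff_stdCuspidalCrossCap.contDiffOn hmem
  have hsm : ContDiffOn ℝ ∞ (fun y => fderiv ℝ Φ.symm (stdCuspidalCrossCap y) (stdReduced y))
      φ.target := hc.clm_apply contDiff_stdReduced.contDiffOn
  have hsnd (y) (hy : y ∈ φ.target) : fderiv ℝ (f ∘ φ.symm) y (0, 1) =
      y.2 • fderiv ℝ Φ.symm (stdCuspidalCrossCap y) (stdReduced y) := by
    rw [hdF y hy, ← map_smul, fderiv_stdCuspidalCrossCap]
    congr 1
    ext i
    fin_cases i <;> simp [stdReduced] <;> ring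
  refine ⟨φ, _, hpφ, hφp, hU, hf, hφ, hφ', hsU,
    ⟨φ.open_target, hfr, hsm, hsnd, fun y hy => ?_, fun u hu huW hn => ?_⟩⟩
  · set a := fderiv ℝ (f ∘ φ.symm) y (1, 0) with ha
    set b := fderiv ℝ Φ.symm (stdCuspidalCrossCap y) (stdReduced y) with hb
    rw [hdF y hy, fderiv_stdCuspidalCrossCap] at ha
    have ha0 : a ≠ 0 := fun h0 => by
      have := congrArg (fun w : E3 => w 0) (hinj _ (hmem y hy) _ (ha.symm.trans h0))
      simp at this
    have hapos : 0 < ⟪a, a⟫_ℝ := real_inner_self_pos.2 ha0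
    -- Up to the factor `⟪a, a⟫`, this vector is the part of `b` orthogonal to `a`; its squared norm
    -- is `⟪a, a⟫` times the Gram determinant. Its preimage under `dΦ⁻¹` has second coordinate `2
    -- ⟪a, a⟫`.
    have hw : ⟪a, a⟫_ℝ • b - ⟪a, b⟫_ℝ • a ≠ 0 := fun h0 => by
      rw [ha, hb, ← map_smul, ← map_smul, ← map_sub, ← ha, ← hb] at h0
      have := congrArg (fun w : E3 => w 1) (hinj _ (hmem y hy) _ h0)
      simp [stdReduced] at this
      exact ha0 this
    have hwpos := real_inner_self_pos.2 hw
    have e : ⟪⟪a, a⟫_ℝ • b - ⟪a, b⟫_ℝ • a, ⟪a, a⟫_ℝ • b - ⟪a, b⟫_ℝ • a⟫_ℝ =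
        ⟪a, a⟫_ℝ * (⟪a, a⟫_ℝ * ⟪b, b⟫_ℝ - ⟪a, b⟫_ℝ ^ 2) := by
      simp only [inner_sub_left, inner_sub_right, real_inner_smul_left, real_inner_smul_right,
        real_inner_comm a b]
      ring
    rw [e] at hwpos
    exact pos_of_mul_pos_right hwpos hapos.le
  -- If `⟪h_v, N⟫` vanished, `N` would be orthogonal to `F_u`, `h` and `h_v`, the images under
  -- `dΦ⁻¹` of a basis of `ℝ³` when `u ≠ 0`. Then `N = 0`, against `‖N‖ = 1`.
  · have h1 := hfr.perp _ huW (1, 0)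
    rw [hdF _ huW, fderiv_stdCuspidalCrossCap] at h1
    have h2 := hfr.inner_normal_of_fderiv_snd φ.open_target hsm hsnd huW
    have hcd : DifferentiableAt ℝ (fun y => fderiv ℝ Φ.symm (stdCuspidalCrossCap y)) (u, 0) :=
      differentiableAt_of_smooth φ.open_target hc huW
    rw [fderiv_clm_apply hcd (contDiff_stdReduced.differentiable (by simp) _)] at hn
    -- On the axis `∂_v` is null for the model, so `dΦ⁻¹` is stationary in that direction and the
    -- second derivative of `Φ⁻¹` does not enter `h_v`.
    have hz : fderiv ℝ (fun y => fderiv ℝ Φ.symm (stdCuspidalCrossCap y)) (u, 0) (0, 1) = 0 := by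
      rw [show (fun y => fderiv ℝ Φ.symm (stdCuspidalCrossCap y)) =
        fderiv ℝ Φ.symm ∘ stdCuspidalCrossCap from rfl, fderiv_comp _
        ((hfdΨ.contDiffAt (Φ.open_target.mem_nhds (hmem _ huW))).differentiableAt (by simp))
        (hdg _), ContinuousLinearMap.comp_apply, fderiv_stdCuspidalCrossCap]
      have : (!₂[0, 2 * 0 * 1, 0 * 0 ^ 3 + 3 * u * 0 ^ 2 * 1] : E3) = 0 := by
        ext i
        fin_cases i <;> simp
      rw [this, map_zero]
    simp only [add_apply, ContinuousLinearMap.comp_apply,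
      ContinuousLinearMap.flip_apply, hz, zero_apply, add_zero,
      fderiv_stdReduced] at hn
    obtain ⟨w, hw⟩ := hsurj _ (hmem _ huW) ((ν ∘ φ.symm) (u, 0))
    have hdec : w = w 0 • !₂[1, 2 * 0 * 0, 1 * 0 ^ 3 + 3 * u * 0 ^ 2 * 0]
        + (w 1 / 2) • stdReduced (u, 0) + (w 2 / (3 * u)) • !₂[0, 0, 3 * u] := by
      ext i
      fin_cases i <;> simp [stdReduced]
      field_simp
    have hN : ⟪(ν ∘ φ.symm) (u, 0), (ν ∘ φ.symm) (u, 0)⟫_ℝ = 0 := by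
      nth_rewrite 1 [← hw]
      rw [hdec]
      simp only [map_add, map_smul, inner_add_left, real_inner_smul_left, h2, hn]
      simpa using Or.inr h1
    rw [real_inner_self_eq_norm_sq, hfr.unit _ huW] at hN
    norm_num at hN

/-! ### Transfer between the adapted chart and the original coordinates -/

namespace IsAdaptedChart

open IsAdapted

variable {φ : OpenPartialHomeomorph (ℝ × ℝ) (ℝ × ℝ)} {h : ℝ × ℝ → E3}

variable (H : IsAdaptedChart f ν U φ h)
include H

lemma symm_mem {y : ℝ × ℝ} (hy : y ∈ φ.target) : φ.symm y ∈ U :=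
  H.source_subset (φ.map_target hy)

lemma differentiableAt_symm {y : ℝ × ℝ} (hy : y ∈ φ.target) : DifferentiableAt ℝ φ.symm y :=
  differentiableAt_of_smooth φ.open_target H.smooth_symm hy

lemma differentiableAt_map {y : ℝ × ℝ} (hy : y ∈ φ.target) :
    DifferentiableAt ℝ f (φ.symm y) :=
  differentiableAt_of_smooth H.isOpen H.frontal.smooth (H.symm_mem hy)

lemma fderiv_symm_apply {y : ℝ × ℝ} (hy : y ∈ φ.target) (X : ℝ × ℝ) :
    fderiv ℝ φ.symm y (fderiv ℝ φ (φ.symm y) X) = X := by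
  have := DFunLike.congr_fun
    (fderiv_symm_comp_fderiv φ H.smooth H.smooth_symm (φ.map_target hy)) X
  rwa [φ.right_inv hy] at this

lemma jac_ne_zero {y : ℝ × ℝ} (hy : y ∈ φ.target) : jac (fderiv ℝ φ.symm y) ≠ 0 :=
  jac_ne_zero_of_comp_eq_id (fderiv_symm_comp_fderiv φ.symm H.smooth_symm H.smooth hy)

lemma gaussCurvature_eq {y : ℝ × ℝ} (hy : y ∈ φ.target) :
    gaussCurvature (f ∘ φ.symm) (ν ∘ φ.symm) y = gaussCurvature f ν (φ.symm y) :=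
  gaussCurvature_comp H.frontal H.isOpen (H.symm_mem hy) (H.differentiableAt_symm hy)
    (H.jac_ne_zero hy)

lemma areaDensity_symm {y : ℝ × ℝ} (hy : y ∈ φ.target) :
    areaDensity (f ∘ φ.symm) (ν ∘ φ.symm) y =
      jac (fderiv ℝ φ.symm y) * areaDensity f ν (φ.symm y) :=
  areaDensity_comp (H.differentiableAt_symm hy) (H.differentiableAt_map hy)

lemma isSingularPt_symm_iff {y : ℝ × ℝ} (hy : y ∈ φ.target) :
    IsSingularPt f ν (φ.symm y) ↔ y.2 = 0 := by
  rw [← H.adapted.isSingularPt_iff hy, IsSingularPt, IsSingularPt, H.areaDensity_symm hy]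
  simp [H.jac_ne_zero hy]

lemma secondForm_symm {y : ℝ × ℝ} (hy : y ∈ φ.target) (X Y : ℝ × ℝ) :
    secondForm (f ∘ φ.symm) (ν ∘ φ.symm) y X Y =
      secondForm f ν (φ.symm y) (fderiv ℝ φ.symm y X) (fderiv ℝ φ.symm y Y) :=
  secondForm_comp (H.differentiableAt_symm hy) (H.differentiableAt_map hy)
    (differentiableAt_of_smooth H.isOpen H.frontal.smooth_normal (H.symm_mem hy)) X Y

/-- The second fundamental form vanishes at a singular point iff its coefficient `L` does. -/
lemma secondForm_eq_zero_iff {y : ℝ × ℝ} (hy : y ∈ φ.target) (hy0 : y.2 = 0) :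
    (∀ X Y, secondForm f ν (φ.symm y) X Y = 0) ↔ coeffL (f ∘ φ.symm) (ν ∘ φ.symm) y = 0 := by
  constructor
  · intro h0
    rw [coeffL, H.secondForm_symm hy, h0]
  · intro h0 X Y
    rw [← H.fderiv_symm_apply hy X, ← H.fderiv_symm_apply hy Y, ← H.secondForm_symm hy,
      H.adapted.secondForm_of_snd_eq_zero hy hy0, h0, mul_zero]

/-- Differentiate `J · (λ ∘ φ⁻¹) = v μ`, where `J` is the Jacobian of `φ⁻¹`. The terms with
derivatives of `J` and `μ` drop out since `λ` and `v` vanish. -/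
lemma fderiv_areaDensity_symm {y : ℝ × ℝ} (hy : y ∈ φ.target) (hy0 : y.2 = 0) (s : ℝ) :
    jac (fderiv ℝ φ.symm y) * fderiv ℝ (areaDensity f ν) (φ.symm y) (fderiv ℝ φ.symm y (0, s)) =
      s * reducedDensity (f ∘ φ.symm) (ν ∘ φ.symm) h y := by
  have hn := φ.open_target.mem_nhds hy
  have e1 : areaDensity (f ∘ φ.symm) (ν ∘ φ.symm) =ᶠ[𝓝 y]
      fun z => z.2 * reducedDensity (f ∘ φ.symm) (ν ∘ φ.symm) h z := by
    filter_upwards [hn] with z hz using H.adapted.areaDensity_eq hz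
  have e2 : areaDensity (f ∘ φ.symm) (ν ∘ φ.symm) =ᶠ[𝓝 y]
      fun z => jac (fderiv ℝ φ.symm z) * (areaDensity f ν ∘ φ.symm) z := by
    filter_upwards [hn] with z hz using H.areaDensity_symm hz
  have d1 := differentiableAt_of_smooth φ.open_target H.adapted.contDiffOn_reducedDensity hy
  have d2 : DifferentiableAt ℝ (fun z => jac (fderiv ℝ φ.symm z)) y := by
    have c (X) := differentiableAt_of_smooth φ.open_target
      (contDiffOn_fderiv_apply φ.open_target H.smooth_symm X) hy
    have c1 := c (1, 0)
    have c2 := c (0, 1)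
    simp only [jac]
    fun_prop
  have d3 : DifferentiableAt ℝ (areaDensity f ν) (φ.symm y) :=
    differentiableAt_of_smooth H.isOpen (contDiffOn_det3
      (contDiffOn_fderiv_apply H.isOpen H.frontal.smooth _)
      (contDiffOn_fderiv_apply H.isOpen H.frontal.smooth _) H.frontal.smooth_normal) (H.symm_mem hy)
  have dψ := H.differentiableAt_symm hy
  have h0 : areaDensity f ν (φ.symm y) = 0 := (H.isSingularPt_symm_iff hy).2 hy0
  have k1 := DFunLike.congr_fun (e1.fderiv_eq (𝕜 := ℝ)) ((0, s) : ℝ × ℝ)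
  rw [e2.fderiv_eq, fderiv_fun_mul d2 (d3.comp y dψ), fderiv_fun_mul differentiableAt_snd d1,
    fderiv_comp y d3 dψ] at k1
  simpa [h0, hy0, _root_.fderiv_snd, mul_comm] using k1

/-! ### The singular curve -/

variable {γ : ℝ → ℝ × ℝ} {ε : ℝ}

omit H in
/-- A regular parametrization `t ↦ φ⁻¹ (u t, 0)` of the singular curve on `(-ε₀, ε₀)`. -/
structure IsCurveCoord (φ : OpenPartialHomeomorph (ℝ × ℝ) (ℝ × ℝ)) (γ : ℝ → ℝ × ℝ)
    (u : ℝ → ℝ) (ε₀ : ℝ) : Prop where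
  smooth : ContDiffOn ℝ ∞ u (Ioo (-ε₀) ε₀)
  mem : ∀ t ∈ Ioo (-ε₀) ε₀, ((u t, 0) : ℝ × ℝ) ∈ φ.target
  eq : ∀ t ∈ Ioo (-ε₀) ε₀, γ t = φ.symm (u t, 0)
  deriv_ne : ∀ t ∈ Ioo (-ε₀) ε₀, deriv u t ≠ 0

/-- The chart sends singular points to the axis, so the first coordinate of `φ ∘ γ` determines the
curve. The radius `r` keeps it where the curvature estimate holds. -/
lemma exists_curveCoord (hγ : IsSingularCurve f ν U p γ ε) (hp : p ∈ φ.source)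
    (hφp : φ p = 0) {r : ℝ} (hr : 0 < r) :
    ∃ ε₀ u, 0 < ε₀ ∧ ε₀ ≤ ε ∧ IsCurveCoord φ γ u ε₀ ∧
      ∀ t ∈ Ioo (-ε₀) ε₀, ((u t, 0) : ℝ × ℝ) ∈ Metric.ball (0 : ℝ × ℝ) r := by
  have h0 : (0 : ℝ) ∈ Ioo (-ε) ε := by simp [hγ.pos]
  have hγ0 : ContinuousAt γ 0 := hγ.smooth.continuousOn.continuousAt (isOpen_Ioo.mem_nhds h0)
  have hφ0 : ContinuousAt φ (γ 0) := by rw [hγ.base]; exact φ.continuousAt hp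
  have e1 : ∀ᶠ t in 𝓝 (0 : ℝ), γ t ∈ φ.source :=
    hγ0 (φ.open_source.mem_nhds (by rwa [hγ.base]))
  have e2 : ∀ᶠ t in 𝓝 (0 : ℝ), φ (γ t) ∈ Metric.ball (0 : ℝ × ℝ) r :=
    (ContinuousAt.comp (g := φ) (f := γ) hφ0 hγ0)
      (Metric.isOpen_ball.mem_nhds (by simp [hγ.base, hφp, hr]))
  obtain ⟨ρ, hρ, hball⟩ := Metric.eventually_nhds_iff_ball.1 (e1.and e2)
  have hI (t) (ht : t ∈ Ioo (-min ρ ε) (min ρ ε)) :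
      t ∈ Ioo (-ε) ε ∧ γ t ∈ φ.source ∧ φ (γ t) ∈ Metric.ball (0 : ℝ × ℝ) r := by
    rw [mem_Ioo, ← abs_lt, lt_min_iff] at ht
    exact ⟨abs_lt.1 ht.2, hball t (by simpa using ht.1)⟩
  have hσ (t) (ht : t ∈ Ioo (-min ρ ε) (min ρ ε)) : ((φ (γ t)).1, (0 : ℝ)) = φ (γ t) := by
    obtain ⟨h1, h2, -⟩ := hI t ht
    have := (hγ.nondeg t h1).1
    rw [← φ.left_inv h2, H.isSingularPt_symm_iff (φ.map_source h2)] at this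
    exact Prod.ext rfl this.symm
  have hsm : ContDiffOn ℝ ∞ (fun t => (φ (γ t)).1) (Ioo (-min ρ ε) (min ρ ε)) :=
    contDiff_fst.comp_contDiffOn (H.smooth.comp (hγ.smooth.mono fun t ht => (hI t ht).1)
      fun t ht => (hI t ht).2.1)
  have heq (t) (ht : t ∈ Ioo (-min ρ ε) (min ρ ε)) : γ t = φ.symm ((φ (γ t)).1, 0) := by
    rw [hσ t ht, φ.left_inv (hI t ht).2.1]
  have hmem (t) (ht : t ∈ Ioo (-min ρ ε) (min ρ ε)) : ((φ (γ t)).1, (0 : ℝ)) ∈ φ.target := by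
    rw [hσ t ht]
    exact φ.map_source (hI t ht).2.1
  refine ⟨min ρ ε, fun t => (φ (γ t)).1, lt_min hρ hγ.pos, min_le_right _ _,
    ⟨hsm, hmem, heq, fun t ht h0 => ?_⟩, fun t ht => ?_⟩
  · have hd : HasDerivAt (fun t => (φ (γ t)).1) 0 t := by
      rw [← h0]
      exact ((hsm.contDiffAt (isOpen_Ioo.mem_nhds ht)).differentiableAt (by simp)).hasDerivAt
    have hc := (H.differentiableAt_symm (hmem t ht)).hasFDerivAt.comp_hasDerivAt t
      (hd.prodMk (hasDerivAt_const t (0 : ℝ)))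
    have he : γ =ᶠ[𝓝 t] φ.symm ∘ fun t => ((φ (γ t)).1, (0 : ℝ)) := by
      filter_upwards [isOpen_Ioo.mem_nhds ht] with s hs using heq s hs
    refine hγ.regular t (hI t ht).1 ?_
    rw [he.deriv_eq, hc.deriv]
    exact map_zero _
  · rw [hσ t ht]
    exact (hI t ht).2.2

variable {u : ℝ → ℝ} {ε₀ : ℝ}

omit H in
lemma IsCurveCoord.hasDerivAt (hu : IsCurveCoord φ γ u ε₀) {t : ℝ} (ht : t ∈ Ioo (-ε₀) ε₀) :
    HasDerivAt (fun t => ((u t, 0) : ℝ × ℝ)) (deriv u t, 0) t :=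
  ((hu.smooth.contDiffAt (isOpen_Ioo.mem_nhds ht)).differentiableAt
    (by simp)).hasDerivAt.prodMk (hasDerivAt_const t (0 : ℝ))

omit H in
lemma IsCurveCoord.isOpen_image (hu : IsCurveCoord φ γ u ε₀) {δ : ℝ} (hδ : δ ≤ ε₀) :
    IsOpen (u '' Ioo (-δ) δ) := by
  rw [isOpen_iff_mem_nhds]
  rintro _ ⟨t, ht, rfl⟩
  have ht' : t ∈ Ioo (-ε₀) ε₀ := Ioo_subset_Ioo (neg_le_neg hδ) hδ ht
  have hs := (hu.smooth.contDiffAt (isOpen_Ioo.mem_nhds ht')).hasStrictDerivAt (by simp)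
  rw [← hs.map_nhds_eq (hu.deriv_ne t ht')]
  exact image_mem_map (isOpen_Ioo.mem_nhds ht)

lemma deriv_curve (hu : IsCurveCoord φ γ u ε₀) {t : ℝ} (ht : t ∈ Ioo (-ε₀) ε₀) :
    deriv γ t = fderiv ℝ φ.symm (u t, 0) (deriv u t, 0) := by
  have he : γ =ᶠ[𝓝 t] φ.symm ∘ fun t => ((u t, 0) : ℝ × ℝ) := by
    filter_upwards [isOpen_Ioo.mem_nhds ht] with s hs using hu.eq s hs
  rw [he.deriv_eq, ((H.differentiableAt_symm (hu.mem t ht)).hasFDerivAt.comp_hasDerivAt t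
    (hu.hasDerivAt ht)).deriv]

lemma deriv_space_curve (hu : IsCurveCoord φ γ u ε₀) {t : ℝ} (ht : t ∈ Ioo (-ε₀) ε₀) :
    deriv (f ∘ γ) t = deriv u t • fderiv ℝ (f ∘ φ.symm) (u t, 0) (1, 0) := by
  have he : f ∘ γ =ᶠ[𝓝 t] (f ∘ φ.symm) ∘ fun t => ((u t, 0) : ℝ × ℝ) := by
    filter_upwards [isOpen_Ioo.mem_nhds ht] with s hs
    exact congrArg f (hu.eq s hs)
  have hd := (differentiableAt_of_smooth φ.open_target H.adapted.frontal.smooth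
    (hu.mem t ht)).hasFDerivAt.comp_hasDerivAt t (hu.hasDerivAt ht)
  rw [he.deriv_eq, hd.deriv, clm_prod_apply _ (deriv u t, 0)]
  simp

lemma deriv_deriv_space_curve (hu : IsCurveCoord φ γ u ε₀) {t : ℝ} (ht : t ∈ Ioo (-ε₀) ε₀) :
    deriv (deriv (f ∘ γ)) t = deriv u t ^ 2 •
        fderiv ℝ (fun z => fderiv ℝ (f ∘ φ.symm) z (1, 0)) (u t, 0) (1, 0)
      + deriv (deriv u) t • fderiv ℝ (f ∘ φ.symm) (u t, 0) (1, 0) := by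
  have he : deriv (f ∘ γ) =ᶠ[𝓝 t]
      fun t => deriv u t • fderiv ℝ (f ∘ φ.symm) (u t, 0) (1, 0) := by
    filter_upwards [isOpen_Ioo.mem_nhds ht] with s hs using H.deriv_space_curve hu hs
  have hd := (differentiableAt_of_smooth φ.open_target (contDiffOn_fderiv_apply φ.open_target
    H.adapted.frontal.smooth (1, 0)) (hu.mem t ht)).hasFDerivAt.comp_hasDerivAt t
    (hu.hasDerivAt ht)
  have hu' : HasDerivAt (deriv u) (deriv (deriv u) t) t :=
    (((hu.smooth.deriv_of_isOpen isOpen_Ioo (m := ∞) (by simp)).contDiffAt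
      (isOpen_Ioo.mem_nhds ht)).differentiableAt (by simp)).hasDerivAt
  have hs : deriv (fun t => deriv u t • fderiv ℝ (f ∘ φ.symm) (u t, 0) (1, 0)) t = _ :=
    (hu'.smul hd).deriv
  rw [he.deriv_eq, hs, clm_prod_apply _ (deriv u t, 0)]
  simp [smul_smul, pow_two]

/-- Since `c' = u' F_u` and `c'' = u'² F_uu + u'' F_u`, the `u''` term is parallel to `c'` and drops
out. -/
lemma det3_space_curve (hu : IsCurveCoord φ γ u ε₀) {t : ℝ} (ht : t ∈ Ioo (-ε₀) ε₀) :
    det3 (deriv (f ∘ γ) t) (deriv (deriv (f ∘ γ)) t) (ν (γ t)) =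
      deriv u t ^ 3 * lineDet (f ∘ φ.symm) (ν ∘ φ.symm) (u t, 0) := by
  rw [H.deriv_space_curve hu ht, H.deriv_deriv_space_curve hu ht, hu.eq t ht, lineDet]
  simp only [det3_eq, PiLp.add_apply, PiLp.smul_apply, smul_eq_mul, Function.comp]
  ring

lemma fderiv_fst_ne_zero {y : ℝ × ℝ} (hy : y ∈ φ.target) :
    fderiv ℝ (f ∘ φ.symm) y (1, 0) ≠ 0 := fun h0 => by
  have := H.adapted.gram_pos y hy
  simp [h0] at this

omit H in
lemma frame_det (A : ℝ × ℝ →L[ℝ] ℝ × ℝ) (a s : ℝ) :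
    (A (a, 0)).1 * (A (0, s)).2 - (A (a, 0)).2 * (A (0, s)).1 = a * s * jac A := by
  rw [clm_prod_apply A (a, 0), clm_prod_apply A (0, s)]
  simp only [jac, zero_smul, add_zero, zero_add, Prod.smul_fst, Prod.smul_snd, smul_eq_mul]
  ring

lemma exists_isPositiveNullVector (hu : IsCurveCoord φ γ u ε₀) {t : ℝ}
    (ht : t ∈ Ioo (-ε₀) ε₀) : ∃ η, IsPositiveNullVector f γ t η := by
  have hm := hu.mem t ht
  -- The factor `u' J` on `∂_v` makes the frame determinant the square `(u' J)²`.
  refine ⟨fderiv ℝ φ.symm (u t, 0) (0, deriv u t * jac (fderiv ℝ φ.symm (u t, 0))), ?_, ?_⟩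
  · rw [hu.eq t ht, ← fderiv_comp_apply' (H.differentiableAt_symm hm) (H.differentiableAt_map hm),
      clm_prod_apply, H.adapted.fderiv_snd _ hm]
    simp
  · rw [H.deriv_curve hu ht, frame_det]
    have h1 := hu.deriv_ne t ht
    have h2 := H.jac_ne_zero hm
    have : 0 < (deriv u t * jac (fderiv ℝ φ.symm (u t, 0))) ^ 2 := by positivity
    linarith

/-- On the axis `F_v = 0` and `F_u ≠ 0`, so every null vector is a multiple of `∂_v`; positivity of
the frame then fixes the sign of `u' s J`. -/
lemma exists_of_isPositiveNullVector (hu : IsCurveCoord φ γ u ε₀) {t : ℝ}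
    (ht : t ∈ Ioo (-ε₀) ε₀) {η : ℝ × ℝ} (hη : IsPositiveNullVector f γ t η) :
    ∃ s, η = fderiv ℝ φ.symm (u t, 0) (0, s) ∧
      0 < deriv u t * s * jac (fderiv ℝ φ.symm (u t, 0)) := by
  have hm := hu.mem t ht
  obtain ⟨h1, h2⟩ := hη
  have hA := H.fderiv_symm_apply hm η
  set ξ := fderiv ℝ φ (φ.symm (u t, 0)) η with hξ
  rw [hu.eq t ht, ← hA,
    ← fderiv_comp_apply' (H.differentiableAt_symm hm) (H.differentiableAt_map hm),
    clm_prod_apply, H.adapted.fderiv_snd _ hm] at h1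
  have h0 : ξ.1 = 0 := by simpa [H.fderiv_fst_ne_zero hm] using h1
  have he : ξ = (0, ξ.2) := Prod.ext h0 rfl
  rw [he] at hA
  refine ⟨ξ.2, hA.symm, ?_⟩
  rwa [H.deriv_curve hu ht, ← hA, frame_det] at h2

lemma singularCurvature_nonpos (hu : IsCurveCoord φ γ u ε₀) {t : ℝ} (ht : t ∈ Ioo (-ε₀) ε₀)
    (hle : lineDet (f ∘ φ.symm) (ν ∘ φ.symm) (u t, 0) *
      reducedDensity (f ∘ φ.symm) (ν ∘ φ.symm) h (u t, 0) ≤ 0)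
    {η : ℝ × ℝ} (hη : IsPositiveNullVector f γ t η) : singularCurvature f ν γ t η ≤ 0 := by
  obtain ⟨s, rfl, hs⟩ := H.exists_of_isPositiveNullVector hu ht hη
  have hd := H.fderiv_areaDensity_symm (hu.mem t ht) rfl s
  rw [singularCurvature, H.det3_space_curve hu ht]
  refine div_nonpos_of_nonpos_of_nonneg ?_ (by positivity)
  rw [hu.eq t ht]
  set J := jac (fderiv ℝ φ.symm (u t, 0))
  set d := fderiv ℝ (areaDensity f ν) (φ.symm (u t, 0)) (fderiv ℝ φ.symm (u t, 0) (0, s))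
  set k := lineDet (f ∘ φ.symm) (ν ∘ φ.symm) (u t, 0)
  set μ := reducedDensity (f ∘ φ.symm) (ν ∘ φ.symm) h (u t, 0)
  have hJ : J ≠ 0 := H.jac_ne_zero (hu.mem t ht)
  have hdk : d * (deriv u t ^ 3 * k) ≤ 0 := by
    -- Substituting `J d = s μ` collects the signs of `u'`, `s` and `J` into the orientation factor
    -- `u' s J > 0`.
    have e : J ^ 2 * (d * (deriv u t ^ 3 * k)) =
        deriv u t ^ 2 * (deriv u t * s * J) * (k * μ) := by
      linear_combination J * deriv u t ^ 3 * k * hd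
    have h1 : J ^ 2 * (d * (deriv u t ^ 3 * k)) ≤ 0 := by
      rw [e]
      exact mul_nonpos_of_nonneg_of_nonpos (by positivity) hle
    exact nonpos_of_mul_nonpos_right h1 (by positivity)
  rcases lt_trichotomy d 0 with h | h | h
  · rw [sign_neg h]
    have := nonneg_of_mul_nonpos_right hdk h
    simpa using this
  · simp [h]
  · rw [sign_pos h]
    have := nonpos_of_mul_nonpos_right hdk h
    simpa using this

end IsAdaptedChart

end Frontal

/-! ### Boundedness of the Gaussian curvature and sign of the singular curvature -/

theorem mainTheorem8
    (U : Set (ℝ × ℝ)) (hU : IsOpen U) (hUc : IsConnected U)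
    (f ν : ℝ × ℝ → E3) (hf : IsFrontalWith f ν U)
    (p : ℝ × ℝ) (hp : p ∈ U) (hccc : IsCuspidalCrossCap f U p)
    (γ : ℝ → ℝ × ℝ) (ε : ℝ) (hγ : IsSingularCurve f ν U p γ ε) :
    ∃ ε₀ : ℝ, 0 < ε₀ ∧ ε₀ ≤ ε ∧
      -- boundedness of the Gaussian curvature
      (∀ δ : ℝ, 0 < δ → δ ≤ ε₀ →
        (CurvatureBoundedNear f ν U (γ '' Set.Ioo (-δ) δ) ↔
          SecondFormVanishesOn f ν (γ '' Set.Ioo (-δ) δ))) ∧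
      -- the singular curvature is defined along the singular curve near the base point
      (∀ t ∈ Set.Ioo (-ε₀) ε₀, ∃ η : ℝ × ℝ, IsPositiveNullVector f γ t η) ∧
      -- sign of the singular curvature
      (∀ V : Set (ℝ × ℝ), IsOpen V → V ⊆ U → p ∈ V →
        (∀ x ∈ V, ¬ IsSingularPt f ν x → 0 ≤ gaussCurvature f ν x) →
        ∀ t ∈ Set.Ioo (-ε₀) ε₀, γ t ∈ V →
          ∀ η : ℝ × ℝ, IsPositiveNullVector f γ t η →
            singularCurvature f ν γ t η ≤ 0) := by
  obtain ⟨φ, h, hpφ, hφp, H⟩ := hccc.exists_adaptedChart hU hf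
  have h0 : (0 : ℝ × ℝ) ∈ φ.target := hφp ▸ φ.map_source hpφ
  obtain ⟨r, hr, hrW, C, hC⟩ := H.adapted.exists_ball_curvature_bounded h0
  obtain ⟨ε₀, u, hε₀, hε₀ε, hu, hball⟩ := H.exists_curveCoord hγ hpφ hφp hr
  refine ⟨ε₀, hε₀, hε₀ε, fun δ _ hδ => ?_,
    fun t ht => H.exists_isPositiveNullVector hu ht, ?_⟩
  · have hsub : Ioo (-δ) δ ⊆ Ioo (-ε₀) ε₀ := Ioo_subset_Ioo (neg_le_neg hδ) hδ
    have hS := hu.isOpen_image hδ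
    constructor
    · rintro ⟨V, hV, -, hJV, C', hC'⟩
      have hL := H.adapted.coeffL_eq_zero_of_mul hS
        (by rintro _ ⟨t, ht, rfl⟩; exact hu.mem t (hsub ht)) (by
          rintro _ ⟨t, ht, rfl⟩
          have hm := hu.mem t (hsub ht)
          refine H.adapted.coeff_mul_eq_zero_of_bounded (C := C') hm ?_
          have hγV : φ.symm (u t, 0) ∈ V := hu.eq t (hsub ht) ▸ hJV (mem_image_of_mem γ ht)
          filter_upwards [φ.open_target.mem_nhds hm,
            (φ.symm.continuousAt hm) (hV.mem_nhds hγV)] with y hy hyV hy0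
          rw [H.gaussCurvature_eq hy]
          exact hC' _ hyV (by rwa [H.isSingularPt_symm_iff hy]))
      rintro _ ⟨t, ht, rfl⟩
      rw [hu.eq t (hsub ht)]
      exact (H.secondForm_eq_zero_iff (hu.mem t (hsub ht)) rfl).2 (hL _ (mem_image_of_mem u ht))
    · intro hII
      -- Vanishing of the second form is known on `J_δ` only, so the ball is cut down to the strip
      -- over `u((-δ, δ))`: each of its points then has its foot on the image of `J_δ`, where `L =
      -- 0`.
      refine ⟨φ.source ∩ φ ⁻¹' (Metric.ball 0 r ∩ Prod.fst ⁻¹' (u '' Ioo (-δ) δ)),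
        φ.isOpen_inter_preimage (Metric.isOpen_ball.inter (hS.preimage continuous_fst)),
        fun x hx => H.source_subset hx.1, ?_, C, ?_⟩
      · rintro _ ⟨t, ht, rfl⟩
        have hm := hu.mem t (hsub ht)
        rw [hu.eq t (hsub ht)]
        refine ⟨φ.map_target hm, ?_⟩
        rw [mem_preimage, φ.right_inv hm]
        exact ⟨hball t (hsub ht), mem_image_of_mem u ht⟩
      · rintro x ⟨hx, hxr, t, ht, htx⟩ hreg
        have hm := φ.map_source hx
        rw [← φ.left_inv hx, H.isSingularPt_symm_iff hm] at hreg
        rw [← φ.left_inv hx, ← H.gaussCurvature_eq hm]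
        refine hC _ hxr hreg ?_
        rw [← htx, ← H.secondForm_eq_zero_iff (hu.mem t (hsub ht)) rfl, ← hu.eq t (hsub ht)]
        exact hII _ (mem_image_of_mem γ ht)
  · intro V hV _ _ hK t ht htV η hη
    refine H.singularCurvature_nonpos hu ht ?_ hη
    refine H.adapted.lineDet_mul_nonpos_of_curvature_nonneg
      (V := φ.target ∩ φ.symm ⁻¹' V) (φ.symm.isOpen_inter_preimage hV) inter_subset_left
      (fun y hy hy0 => ?_) ⟨hu.mem t ht, ?_⟩
    · rw [H.gaussCurvature_eq hy.1]
      exact hK _ hy.2 (by rwa [H.isSingularPt_symm_iff hy.1])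
    · rw [mem_preimage, ← hu.eq t ht]
      exact htV
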